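/- Let $d\ge 1$ be an integer and let $s\in\mathbb{R}$ satisfy $s\le -\tfrac12$ if $d=1$, and $s<0$ if $d\ge 2$. Let $\mu\in\{1,-1\}$. Then the quintic fourth-order nonlinear Schrödinger equation $$ i\partial_t u+\Delta^2u+\mu|u|^4u=0 \qquad (x\in\mathbb{R}^d) $$ exhibits norm inflation at every $u_0\in H^s(\mathbb{R}^d)$. That is, for every $u_0\in H^s(\mathbb{R}^d)$ and every $\varepsilon>0$ there are $T>0$, a solution $u$ of the equation on $[0,T]$, and a time $t\in(0,\varepsilon)$ with $t\le T$, such that $$ \|u(0)-u_0\|_{H^s}<\varepsilon \qquad\text{and}\qquad \|u(t)\|_{H^s}>\varepsilon^{-1}. $$ Here $\|f\|_{H^s}=\|\langle\xi\rangle^s\hat f\|_{L^2}$ with $\langle\xi\rangle=(1+|\xi|^2)^{1/2}$, and $FL^1$ is the space of (bounded continuous) functions $f$ with $\|f\|_{FL^1}=\|\hat f\|_{L^1}<\infty$. A solution on $[0,T]$ is a function $u\in C([0,T],FL^1(\mathbb{R}^d))\cap C([0,T],H^s(\mathbb{R}^d))$ which is differentiable in time as a map into the tempered distributions (tested against each Schwartz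 function, one-sidedly at the end points) and satisfies the equation in the sense of tempered distributions at every $t\in[0,T]$. -/

import Mathlib

open MeasureTheory TemperedDistribution Set Filter Topology
open scoped SchwartzMap FourierTransform Laplacian ENNReal BoundedContinuousFunction

namespace QuinticFourthOrderNLS

/-- The Euclidean space `ℝ^d`. -/
abbrev Space (d : ℕ) : Type := EuclideanSpace ℝ (Fin d)

/-- The Fourier-Lebesgue norm `‖⟨ξ⟩^s 𝓕f‖_{L^p}` of a tempered distribution, where
`⟨ξ⟩ = (1 + |ξ|²)^(1/2)`. It is the `L^p` norm of the (unique) `L^p` function that represents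
`⟨ξ⟩^s 𝓕f`, and it is `⊤` if there is no such function. With Mathlib's convention for the Fourier
transform, `ξ` is the frequency of `exp (2πi⟨ξ, x⟩)`; other conventions give equivalent norms. -/
noncomputable def fourierLebesgueNorm {d : ℕ} (s : ℝ) (p : ℝ≥0∞) [Fact (1 ≤ p)]
    (f : 𝓢'(Space d, ℂ)) : ℝ≥0∞ :=
  ⨅ (g : Lp ℂ p (volume : Measure (Space d)))
    (_ : smulLeftCLM ℂ (fun ξ : Space d ↦ (((1 + ‖ξ‖ ^ 2) ^ (s / 2) : ℝ) : ℂ)) (𝓕 f) =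
      (g : 𝓢'(Space d, ℂ))), ‖g‖ₑ

/-- The norm of the Fourier-Lebesgue space `FL¹`. -/
noncomputable def fl1Norm {d : ℕ} (f : 𝓢'(Space d, ℂ)) : ℝ≥0∞ :=
  fourierLebesgueNorm 0 1 f

/-- The norm of the Sobolev space `H^s`, with value `⊤` outside `H^s`. The space `H^s` itself is
Mathlib's `TemperedDistribution.MemSobolev s 2`. -/
noncomputable def sobolevNorm {d : ℕ} (s : ℝ) (f : 𝓢'(Space d, ℂ)) : ℝ≥0∞ :=
  fourierLebesgueNorm s 2 f

/-- The tempered distribution `φ ↦ ∫ φ f` defined by a bounded continuous function `f`. -/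
noncomputable def toDistribution {d : ℕ} (f : Space d →ᵇ ℂ) : 𝓢'(Space d, ℂ) :=
  ((f.memLp_top (μ := volume)).toLp f : Lp ℂ ∞ (volume : Measure (Space d)))

/-- The quintic nonlinearity `|f|⁴ f`. -/
noncomputable def quintic {d : ℕ} (f : Space d →ᵇ ℂ) : Space d →ᵇ ℂ :=
  BoundedContinuousFunction.ofNormedAddCommGroup (fun x ↦ ((‖f x‖ ^ 4 : ℝ) : ℂ) * f x)
    (by fun_prop) (‖f‖ ^ 4 * ‖f‖) (fun x ↦ by
      have h := f.norm_coe_le_norm x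
      rw [norm_mul, Complex.norm_real, norm_pow, norm_norm]
      gcongr)

/-- `u ∈ C([0,T], X)`, where `X` consists of the distributions with finite norm `N`. -/
def ContinuousInNorm {d : ℕ} (N : 𝓢'(Space d, ℂ) → ℝ≥0∞) (T : ℝ) (u : ℝ → Space d →ᵇ ℂ) : Prop :=
  ∀ t ∈ Icc 0 T, N (toDistribution (u t)) < ∞ ∧
    Tendsto (fun τ ↦ N (toDistribution (u τ) - toDistribution (u t))) (𝓝[Icc 0 T] t) (𝓝 0)

/-- `u` is a solution on `[0,T]`, in `C([0,T], FL¹) ∩ C([0,T], H^s)`, of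
`i ∂ₜu + Δ²u + μ|u|⁴u = 0`. Elements of `FL¹` are bounded continuous functions. At every time the
equation holds in the space of tempered distributions, and `v` is the time derivative of `u`
there (one-sided at the end points). -/
structure IsSolution {d : ℕ} (μ s T : ℝ) (u : ℝ → Space d →ᵇ ℂ) : Prop where
  continuous_fl1 : ContinuousInNorm fl1Norm T u
  continuous_sobolev : ContinuousInNorm (sobolevNorm s) T u
  equation : ∀ t ∈ Icc 0 T, ∃ v : 𝓢'(Space d, ℂ),
    (∀ φ : 𝓢(Space d, ℂ),
      HasDerivWithinAt (fun τ ↦ toDistribution (u τ) φ) (v φ) (Icc 0 T) t) ∧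
    Complex.I • v + Δ (Δ (toDistribution (u t))) + (μ : ℂ) • toDistribution (quintic (u t)) = 0

/-- Norm inflation at `u₀` in `H^s`: for every `ε > 0` there are a (local in time) solution `u` and
a time `t ∈ (0,ε)` in its interval of existence such that `‖u(0) - u₀‖_{H^s} < ε` and
`‖u(t)‖_{H^s} > 1/ε`. -/
def NormInflationAt {d : ℕ} (μ s : ℝ) (u₀ : 𝓢'(Space d, ℂ)) : Prop :=
  ∀ ε : ℝ, 0 < ε → ∃ T : ℝ, 0 < T ∧ ∃ u : ℝ → Space d →ᵇ ℂ, IsSolution μ s T u ∧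
    sobolevNorm s (toDistribution (u 0) - u₀) < ENNReal.ofReal ε ∧
    ∃ t ∈ Ioo 0 ε, t ≤ T ∧ ENNReal.ofReal (1 / ε) < sobolevNorm s (toDistribution (u t))

end QuinticFourthOrderNLS

/-!
On the Fourier side and in the interaction picture `z t = exp (-i t σ) û t`, `σ = (2π|ξ|)⁴`, the
equation becomes an ordinary differential equation in `C₀ ∩ L¹`, where `|u|⁴u` turns into a fivefold
convolution form, bounded in `L¹` and, through any one of its arguments, in the sup norm.

Approximate `u₀` in `H^s` by `ψ` with compactly supported transform and add to the transform of `ψ`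
two tents of height `R` and radius `A`, centred at `η` and `2η` with `|η| = N`. They are small in
`H^s`, but the resonance `η - 2η + η - 2η + 2η = 0` transfers mass to the frequencies `|ξ| < A / 2`.
Up to the time `T = δ / N⁴`, with `δ` small, the phases have not rotated, so the difference of the
solutions with and without the tents is there essentially `T` times the quintic form of the tents,
of size `(R A^d / N)⁴ R`. For `s < d / 2 - 1`, powers `A = N^a`, `R = N^(1 - a d)` make this
large in `H^s`; for `d = 1`, `s = -1/2`, the logarithmic divergence of `∫_{|ξ| < A} ⟨ξ⟩^(-1) dξ`
does.
-/

namespace QuinticFourthOrderNLS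

open scoped ZeroAtInfty Convolution

theorem exists_hasDerivWithinAt_mem_closedBall {E : Type*} [NormedAddCommGroup E]
    [NormedSpace ℝ E] [CompleteSpace E] {f : ℝ → E → E} {tmin tmax : ℝ} {t₀ : Icc tmin tmax}
    {x₀ : E} {a L K : NNReal} (hf : IsPicardLindelof f t₀ x₀ a 0 L K) :
    ∃ α : ℝ → E, α t₀ = x₀ ∧ (∀ t ∈ Icc tmin tmax, α t ∈ Metric.closedBall x₀ a) ∧
      ∀ t ∈ Icc tmin tmax, HasDerivWithinAt α (f t (α t)) (Icc tmin tmax) t := by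
  have hx : x₀ ∈ Metric.closedBall x₀ ((0 : NNReal) : ℝ) := Metric.mem_closedBall_self le_rfl
  obtain ⟨α, hα⟩ := ODE.FunSpace.exists_isFixedPt_next hf hx
  refine ⟨α.compProj, by rw [ODE.FunSpace.compProj_val, ← hα, ODE.FunSpace.next_apply₀],
    fun t _ ↦ α.compProj_mem_closedBall hf.mul_max_le, fun t ht ↦ ?_⟩
  have hmem (t' : ℝ) : α.compProj t' ∈ Metric.closedBall x₀ a :=
    α.compProj_mem_closedBall hf.mul_max_le
  refine (ODE.hasDerivWithinAt_picard_Icc t₀.2 hf.continuousOn_uncurry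
    α.continuous_compProj.continuousOn (fun t' _ ↦ hmem t') x₀ ht).congr_of_mem
    (fun t' ht' ↦ ?_) ht
  nth_rw 1 [← hα]
  rw [ODE.FunSpace.compProj_of_mem ht', ODE.FunSpace.next_apply]

theorem norm_sub_sub_smul_le {E : Type*} [NormedAddCommGroup E] [NormedSpace ℝ E]
    {f f' : ℝ → E} {T C : ℝ} {c : E}
    (hf : ∀ t ∈ Icc 0 T, HasDerivWithinAt f (f' t) (Icc 0 T) t)
    (hC : ∀ t ∈ Icc 0 T, ‖f' t - c‖ ≤ C) {t : ℝ} (ht : t ∈ Icc 0 T) :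
    ‖f t - f 0 - t • c‖ ≤ C * t := by
  have h := Convex.norm_image_sub_le_of_norm_hasDerivWithin_le
    (fun r hr ↦ (hf r hr).sub ((hasDerivWithinAt_id r _).smul_const c))
    (fun r hr ↦ by simpa using hC r hr) (convex_Icc 0 T) ⟨le_rfl, ht.1.trans ht.2⟩ ht
  rw [sub_zero, Real.norm_of_nonneg ht.1] at h
  convert h using 2
  simp only [Pi.sub_apply, id_eq, zero_smul]
  abel

theorem hasDerivWithinAt_clm_apply {E F : Type*} [NormedAddCommGroup E] [NormedSpace ℂ E]
    [NormedAddCommGroup F] [NormedSpace ℂ F] (L : E →L[ℂ] F) {f : ℝ → E} {f' : E} {s : Set ℝ}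
    {t : ℝ} (hf : HasDerivWithinAt f f' s t) :
    HasDerivWithinAt (fun r ↦ L (f r)) (L f') s t :=
  (L.restrictScalars ℝ).hasFDerivAt.comp_hasDerivWithinAt t hf

/-- The pairs in `C₀ × L¹` whose components agree almost everywhere. -/
noncomputable def freqSubmodule (d : ℕ) :
    Submodule ℂ (C₀(Space d, ℂ) × Lp ℂ 1 (volume : Measure (Space d))) where
  carrier := {p | (p.2 : Space d → ℂ) =ᵐ[volume] p.1}
  add_mem' {p q} hp hq := by
    filter_upwards [hp, hq, Lp.coeFn_add p.2 q.2] with x h₁ h₂ h₃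
    rw [Prod.snd_add, h₃, Pi.add_apply, h₁, h₂]; rfl
  zero_mem' := by
    filter_upwards [Lp.coeFn_zero ℂ 1 (volume : Measure (Space d))] with x h
    exact h
  smul_mem' c p hp := by
    filter_upwards [hp, Lp.coeFn_smul c p.2] with x h₁ h₂
    rw [Prod.smul_snd, h₂, Pi.smul_apply, h₁]; rfl

theorem isClosed_freqSubmodule (d : ℕ) :
    IsClosed (freqSubmodule d : Set (C₀(Space d, ℂ) × Lp ℂ 1 (volume : Measure (Space d)))) := by
  refine IsSeqClosed.isClosed fun p q hp hpq ↦ ?_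
  have h₁ : Tendsto (fun n ↦ (p n).1) atTop (𝓝 q.1) := (continuous_fst.tendsto _).comp hpq
  have h₂ : Tendsto (fun n ↦ (p n).2) atTop (𝓝 q.2) := (continuous_snd.tendsto _).comp hpq
  obtain ⟨ns, hns, hlim⟩ := (tendstoInMeasure_of_tendsto_Lp h₂).exists_seq_tendsto_ae
  have hall : ∀ᵐ x ∂(volume : Measure (Space d)), ∀ n, ((p n).2 : Space d → ℂ) x = (p n).1 x :=
    ae_all_iff.2 fun n ↦ hp n
  filter_upwards [hlim, hall] with x hx hx'
  simp only [hx'] at hx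
  exact tendsto_nhds_unique hx
    (((ZeroAtInftyContinuousMap.tendsto_iff_tendstoUniformly.1 h₁).tendsto_at x).comp
      hns.tendsto_atTop)

/-- The Banach space `C₀ ∩ L¹` of functions of the frequency, with the larger of the two norms.
The function is the `C₀` component; the `L¹` component is its class. -/
def FreqSpace (d : ℕ) : Type := freqSubmodule d

namespace FreqSpace

variable {d : ℕ}

noncomputable instance : NormedAddCommGroup (FreqSpace d) :=
  inferInstanceAs (NormedAddCommGroup (freqSubmodule d))

noncomputable instance : NormedSpace ℂ (FreqSpace d) :=
  inferInstanceAs (NormedSpace ℂ (freqSubmodule d))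

instance : CompleteSpace (FreqSpace d) := (isClosed_freqSubmodule d).completeSpace_coe

noncomputable instance : CoeFun (FreqSpace d) (fun _ ↦ Space d → ℂ) := ⟨fun f ↦ f.1.1⟩

theorem coe_ae (f : FreqSpace d) : (f.1.2 : Space d → ℂ) =ᵐ[volume] f := f.2

theorem continuous_coe (f : FreqSpace d) : Continuous f := map_continuous f.1.1

theorem tendsto_zero (f : FreqSpace d) : Tendsto f (cocompact (Space d)) (𝓝 0) :=
  zero_at_infty f.1.1

theorem integrable (f : FreqSpace d) : Integrable f :=
  (L1.integrable_coeFn f.1.2).congr f.coe_ae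

@[ext]
theorem ext {f g : FreqSpace d} (h : ∀ ξ, f ξ = g ξ) : f = g := by
  refine Subtype.ext (Prod.ext (ZeroAtInftyContinuousMap.ext h) (Lp.ext ?_))
  filter_upwards [f.coe_ae, g.coe_ae] with ξ h₁ h₂
  rw [h₁, h₂, h]

/-- The element of `FreqSpace d` given by an integrable function in `C₀`. -/
noncomputable def of (f : Space d → ℂ) (hc : Continuous f)
    (h₀ : Tendsto f (cocompact (Space d)) (𝓝 0)) (hi : Integrable f) : FreqSpace d :=
  ⟨(⟨⟨f, hc⟩, h₀⟩, hi.toL1 f), hi.coeFn_toL1⟩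

@[simp] theorem add_apply (f g : FreqSpace d) (ξ : Space d) : (f + g) ξ = f ξ + g ξ := rfl
@[simp] theorem sub_apply (f g : FreqSpace d) (ξ : Space d) : (f - g) ξ = f ξ - g ξ := rfl
@[simp] theorem smul_apply (c : ℂ) (f : FreqSpace d) (ξ : Space d) : (c • f) ξ = c * f ξ := rfl
@[simp] theorem zero_apply (ξ : Space d) : (0 : FreqSpace d) ξ = 0 := rfl

/-- The projection of `C₀ ∩ L¹` to `C₀`. -/
noncomputable def toC0 : FreqSpace d →L[ℂ] C₀(Space d, ℂ) :=
  (ContinuousLinearMap.fst ℂ _ _).comp (freqSubmodule d).subtypeL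

/-- The projection of `C₀ ∩ L¹` to `L¹`. -/
noncomputable def toL1 : FreqSpace d →L[ℂ] Lp ℂ 1 (volume : Measure (Space d)) :=
  (ContinuousLinearMap.snd ℂ _ _).comp (freqSubmodule d).subtypeL

/-- The supremum norm. -/
noncomputable def supNorm : Seminorm ℂ (FreqSpace d) :=
  (normSeminorm ℂ C₀(Space d, ℂ)).comp toC0.toLinearMap

/-- The `L¹` norm. -/
noncomputable def l1Norm : Seminorm ℂ (FreqSpace d) :=
  (normSeminorm ℂ (Lp ℂ 1 (volume : Measure (Space d)))).comp toL1.toLinearMap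

theorem norm_eq (f : FreqSpace d) : ‖f‖ = max (supNorm f) (l1Norm f) := rfl

theorem l1Norm_le_norm (f : FreqSpace d) : l1Norm f ≤ ‖f‖ := le_max_right _ _

theorem norm_apply_le (f : FreqSpace d) (ξ : Space d) : ‖f ξ‖ ≤ supNorm f :=
  f.1.1.toBCF.norm_coe_le_norm ξ

theorem supNorm_le {f : FreqSpace d} {C : ℝ} (hC : 0 ≤ C) (h : ∀ ξ, ‖f ξ‖ ≤ C) : supNorm f ≤ C :=
  (BoundedContinuousFunction.norm_le (f := f.1.1.toBCF) hC).2 h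

theorem supNorm_mono {f g : FreqSpace d} (h : ∀ ξ, ∃ η, ‖f ξ‖ ≤ ‖g η‖) :
    supNorm f ≤ supNorm g :=
  supNorm_le (apply_nonneg _ _) fun ξ ↦ (h ξ).elim fun η hη ↦ hη.trans (g.norm_apply_le η)

theorem l1Norm_eq (f : FreqSpace d) : l1Norm f = ∫ ξ, ‖f ξ‖ := by
  refine (L1.norm_eq_integral_norm f.1.2).trans (integral_congr_ae ?_)
  filter_upwards [f.coe_ae] with ξ h
  exact congrArg norm h

theorem l1Norm_le_mul {f g : FreqSpace d} {C : ℝ} (h : ∀ ξ, ‖f ξ‖ ≤ C * ‖g ξ‖) :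
    l1Norm f ≤ C * l1Norm g := by
  rw [l1Norm_eq, l1Norm_eq, ← integral_const_mul]
  exact integral_mono f.integrable.norm (g.integrable.norm.const_mul C) h

/-- Evaluation at a frequency. -/
noncomputable def evalCLM (ξ : Space d) : FreqSpace d →L[ℂ] ℂ :=
  LinearMap.mkContinuous ⟨⟨fun f ↦ f ξ, fun _ _ ↦ rfl⟩, fun _ _ ↦ rfl⟩ 1
    fun f ↦ by rw [one_mul]; exact (f.norm_apply_le ξ).trans (le_max_left _ _)

/-! ### The free evolution -/

/-- The symbol `(2π|ξ|)⁴` of `Δ²`, in Mathlib's normalisation of the Fourier transform. -/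
noncomputable def symbol (ξ : Space d) : ℝ := (2 * Real.pi * ‖ξ‖) ^ 4

theorem symbol_nonneg (ξ : Space d) : 0 ≤ symbol ξ := by unfold symbol; positivity

@[fun_prop]
theorem continuous_symbol : Continuous (symbol (d := d)) := by unfold symbol; fun_prop

/-- The phase `exp (it(2π|ξ|)⁴)`, the Fourier multiplier of the free evolution `exp (itΔ²)`. -/
noncomputable def phase (t : ℝ) (ξ : Space d) : ℂ := Complex.exp ((t * symbol ξ : ℝ) * Complex.I)

@[simp]
theorem norm_phase (t : ℝ) (ξ : Space d) : ‖phase t ξ‖ = 1 := Complex.norm_exp_ofReal_mul_I _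

@[fun_prop]
theorem continuous_phase (t : ℝ) : Continuous (phase (d := d) t) := by unfold phase; fun_prop

@[simp]
theorem phase_zero (ξ : Space d) : phase 0 ξ = 1 := by simp [phase]

theorem phase_add (t r : ℝ) (ξ : Space d) : phase (t + r) ξ = phase t ξ * phase r ξ := by
  rw [phase, phase, phase, ← Complex.exp_add]; push_cast; ring_nf

theorem norm_phase_sub_one_le (t : ℝ) (ξ : Space d) : ‖phase t ξ - 1‖ ≤ |t| * symbol ξ := by
  have h := Real.norm_exp_I_mul_ofReal_sub_one_le (x := t * symbol ξ)
  rwa [mul_comm, Real.norm_eq_abs, abs_mul, abs_of_nonneg (symbol_nonneg ξ)] at h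

theorem norm_phase_sub_le (t r : ℝ) (ξ : Space d) :
    ‖phase t ξ - phase r ξ‖ ≤ |t - r| * symbol ξ := by
  have h : phase t ξ - phase r ξ = phase r ξ * (phase (t - r) ξ - 1) := by
    rw [mul_sub, ← phase_add, add_sub_cancel, mul_one]
  rw [h, norm_mul, norm_phase, one_mul]
  exact norm_phase_sub_one_le (t - r) ξ

/-- The free evolution on the frequency side: multiplication by the phase. -/
noncomputable def evol (t : ℝ) (f : FreqSpace d) : FreqSpace d :=
  of (fun ξ ↦ phase t ξ * f ξ) ((continuous_phase t).mul f.continuous_coe)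
    (by
      rw [tendsto_zero_iff_norm_tendsto_zero]
      simpa using f.tendsto_zero.norm)
    (f.integrable.bdd_mul (c := 1) (continuous_phase t).aestronglyMeasurable (by simp))

@[simp]
theorem evol_apply (t : ℝ) (f : FreqSpace d) (ξ : Space d) : evol t f ξ = phase t ξ * f ξ := rfl

theorem evol_sub (t : ℝ) (f g : FreqSpace d) : evol t (f - g) = evol t f - evol t g := by
  ext ξ; simp [mul_sub]

@[simp]
theorem evol_zero (f : FreqSpace d) : evol 0 f = f := by ext ξ; simp

@[simp]
theorem l1Norm_evol (t : ℝ) (f : FreqSpace d) : l1Norm (evol t f) = l1Norm f := by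
  simp [l1Norm_eq]

@[simp]
theorem supNorm_evol (t : ℝ) (f : FreqSpace d) : supNorm (evol t f) = supNorm f :=
  le_antisymm (supNorm_mono fun ξ ↦ ⟨ξ, by simp⟩) (supNorm_mono fun ξ ↦ ⟨ξ, by simp⟩)

@[simp]
theorem norm_evol (t : ℝ) (f : FreqSpace d) : ‖evol t f‖ = ‖f‖ := by simp [norm_eq]

theorem lipschitzWith_evol (t : ℝ) : LipschitzWith 1 (evol (d := d) t) :=
  LipschitzWith.of_dist_le_mul fun f g ↦ by
    rw [dist_eq_norm, dist_eq_norm, ← evol_sub, norm_evol, NNReal.coe_one, one_mul]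

instance : (cocompact (Space d)).IsCountablyGenerated := by
  rw [← Metric.cobounded_eq_cocompact, ← comap_norm_atTop]; infer_instance

theorem norm_evol_sub_apply_le (f : FreqSpace d) (r t : ℝ) (ξ : Space d) :
    ‖(evol r f - evol t f) ξ‖ ≤ |r - t| * symbol ξ * ‖f ξ‖ := by
  rw [sub_apply, evol_apply, evol_apply, ← sub_mul, norm_mul]
  gcongr
  exact norm_phase_sub_le r t ξ

theorem norm_evol_sub_apply_le_two_mul (f : FreqSpace d) (r t : ℝ) (ξ : Space d) :
    ‖(evol r f - evol t f) ξ‖ ≤ 2 * ‖f ξ‖ := by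
  rw [sub_apply, two_mul]
  exact (norm_sub_le _ _).trans (by simp)

theorem tendsto_l1Norm_evol_sub (f : FreqSpace d) (t : ℝ) :
    Tendsto (fun r ↦ l1Norm (evol r f - evol t f)) (𝓝 t) (𝓝 0) := by
  simp only [l1Norm_eq]
  rw [← integral_zero (Space d) ℝ]
  refine tendsto_integral_filter_of_dominated_convergence (fun ξ ↦ 2 * ‖f ξ‖)
    (Eventually.of_forall fun r ↦ (evol r f - evol t f).continuous_coe.norm.aestronglyMeasurable)
    (Eventually.of_forall fun r ↦ Eventually.of_forall fun ξ ↦ ?_) (f.integrable.norm.const_mul 2)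
    (Eventually.of_forall fun ξ ↦ ?_)
  · rw [norm_norm]
    exact norm_evol_sub_apply_le_two_mul f r t ξ
  · have h : Continuous fun r : ℝ ↦ ‖(evol r f - evol t f) ξ‖ := by
      simp only [sub_apply, evol_apply, phase]; fun_prop
    simpa using h.tendsto t

theorem tendsto_supNorm_evol_sub (f : FreqSpace d) (t : ℝ) :
    Tendsto (fun r ↦ supNorm (evol r f - evol t f)) (𝓝 t) (𝓝 0) := by
  refine Metric.tendsto_nhds.2 fun ε hε ↦ ?_
  obtain ⟨K, hK, hfK⟩ : ∃ K, IsCompact K ∧ ∀ ξ ∈ Kᶜ, ‖f ξ‖ < ε / 4 := by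
    have h := Metric.tendsto_nhds.1 f.tendsto_zero (ε / 4) (by positivity)
    simp only [dist_zero_right] at h
    exact mem_cocompact.1 h
  obtain ⟨B, hB⟩ := (hK.image (continuous_symbol (d := d))).bddAbove
  have hlim : Tendsto (fun r ↦ |r - t| * B * supNorm f) (𝓝 t) (𝓝 0) := by
    have h : Continuous fun r : ℝ ↦ |r - t| * B * supNorm f := by fun_prop
    simpa using h.tendsto t
  filter_upwards [hlim.eventually_le_const (half_pos hε)] with r hr
  rw [Real.dist_0_eq_abs, abs_of_nonneg (apply_nonneg _ _)]
  refine (supNorm_le (half_pos hε).le fun ξ ↦ ?_).trans_lt (half_lt_self hε)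
  by_cases hξ : ξ ∈ K
  · calc ‖(evol r f - evol t f) ξ‖ ≤ |r - t| * symbol ξ * ‖f ξ‖ := norm_evol_sub_apply_le f r t ξ
      _ ≤ |r - t| * B * supNorm f := by
        have h := hB ⟨ξ, hξ, rfl⟩
        gcongr
        exacts [mul_nonneg (abs_nonneg _) ((symbol_nonneg ξ).trans h), f.norm_apply_le ξ]
      _ ≤ ε / 2 := hr
  · linarith [norm_evol_sub_apply_le_two_mul f r t ξ, hfK ξ hξ]

theorem continuous_evol (f : FreqSpace d) : Continuous fun t ↦ evol t f := by
  refine continuous_iff_continuousAt.2 fun t ↦ tendsto_iff_norm_sub_tendsto_zero.2 ?_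
  simpa [norm_eq] using (tendsto_supNorm_evol_sub f t).max (tendsto_l1Norm_evol_sub f t)

@[fun_prop]
theorem continuous_evol_prod : Continuous fun p : ℝ × FreqSpace d ↦ evol p.1 p.2 :=
  continuous_prod_of_continuous_lipschitzWith' _ 1 lipschitzWith_evol continuous_evol

/-! ### Convolution -/

theorem integrable_conv_integrand (f g : FreqSpace d) (ξ : Space d) :
    Integrable fun η ↦ f η * g (ξ - η) :=
  f.integrable.mul_bdd (c := supNorm g)
    (g.continuous_coe.comp (by fun_prop)).aestronglyMeasurable
    (Eventually.of_forall fun η ↦ g.norm_apply_le _)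

theorem tendsto_zero_conv (f g : FreqSpace d) :
    Tendsto (fun ξ ↦ ∫ η, f η * g (ξ - η)) (cocompact (Space d)) (𝓝 0) := by
  rw [← integral_zero (Space d) ℂ]
  refine tendsto_integral_filter_of_dominated_convergence (fun η ↦ ‖f η‖ * supNorm g)
    (Eventually.of_forall fun ξ ↦ (f.integrable_conv_integrand g ξ).aestronglyMeasurable)
    (Eventually.of_forall fun ξ ↦ Eventually.of_forall fun η ↦ ?_) (f.integrable.norm.mul_const _)
    (Eventually.of_forall fun η ↦ ?_)
  · rw [norm_mul]
    gcongr
    exact g.norm_apply_le _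
  · have h : Tendsto (fun ξ : Space d ↦ ξ - η) (cocompact (Space d)) (cocompact (Space d)) :=
      (Homeomorph.subRight η).isClosedEmbedding.tendsto_cocompact
    simpa using (g.tendsto_zero.comp h).const_mul (f η)

/-- The convolution of two elements of `C₀ ∩ L¹`. -/
noncomputable def conv (f g : FreqSpace d) : FreqSpace d :=
  of (fun ξ ↦ ∫ η, f η * g (ξ - η))
    (BddAbove.continuous_convolution_right_of_integrable (ContinuousLinearMap.mul ℂ ℂ)
      ⟨supNorm g, by rintro _ ⟨ξ, rfl⟩; exact g.norm_apply_le ξ⟩ f.integrable g.continuous_coe)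
    (tendsto_zero_conv f g)
    (f.integrable.integrable_convolution (ContinuousLinearMap.mul ℂ ℂ) g.integrable)

theorem conv_apply (f g : FreqSpace d) (ξ : Space d) : conv f g ξ = ∫ η, f η * g (ξ - η) := rfl

theorem coe_conv (f g : FreqSpace d) :
    (conv f g : Space d → ℂ) = f ⋆[ContinuousLinearMap.mul ℂ ℂ, volume] g := rfl

theorem conv_comm (f g : FreqSpace d) : conv f g = conv g f := by
  ext ξ
  rw [conv_apply, conv_apply, ← integral_sub_left_eq_self _ volume ξ]
  simp [mul_comm]

theorem conv_add_right (f g h : FreqSpace d) : conv f (g + h) = conv f g + conv f h := by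
  ext ξ
  simp only [conv_apply, add_apply, mul_add]
  exact integral_add (f.integrable_conv_integrand g ξ) (f.integrable_conv_integrand h ξ)

theorem conv_add_left (f g h : FreqSpace d) : conv (f + g) h = conv f h + conv g h := by
  rw [conv_comm, conv_add_right, conv_comm h, conv_comm h]

theorem supNorm_conv_le (f g : FreqSpace d) : supNorm (conv f g) ≤ supNorm f * l1Norm g := by
  refine supNorm_le (by positivity) fun ξ ↦ ?_
  rw [conv_comm, conv_apply, l1Norm_eq, mul_comm, ← integral_mul_const]
  refine norm_integral_le_of_norm_le (g.integrable.norm.mul_const _)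
    (Eventually.of_forall fun η ↦ ?_)
  rw [norm_mul]
  gcongr
  exact f.norm_apply_le _

theorem l1Norm_conv_le (f g : FreqSpace d) : l1Norm (conv f g) ≤ l1Norm f * l1Norm g := by
  have h := integral_convolution (ContinuousLinearMap.mul ℝ ℝ) f.integrable.norm g.integrable.norm
    (μ := volume) (ν := volume)
  rw [l1Norm_eq, l1Norm_eq, l1Norm_eq, ← ContinuousLinearMap.mul_apply' ℝ ℝ, ← h]
  refine integral_mono (conv f g).integrable.norm (f.integrable.norm.integrable_convolution
    (ContinuousLinearMap.mul ℝ ℝ) g.integrable.norm) fun ξ ↦ ?_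
  refine (norm_integral_le_integral_norm _).trans (le_of_eq ?_)
  simp [convolution_def]

/-- The involution `f ↦ conj (f (-ξ))`, which is complex conjugation in physical space. -/
noncomputable def refl (f : FreqSpace d) : FreqSpace d :=
  of (fun ξ ↦ (starRingEnd ℂ) (f (-ξ)))
    (Complex.continuous_conj.comp (f.continuous_coe.comp continuous_neg))
    (by
      have h : Tendsto (fun ξ : Space d ↦ -ξ) (cocompact (Space d)) (cocompact (Space d)) :=
        (Homeomorph.neg (Space d)).isClosedEmbedding.tendsto_cocompact
      simpa [Function.comp_def] using
        (Complex.continuous_conj.tendsto 0).comp (f.tendsto_zero.comp h))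
    (Complex.conjCLE.toContinuousLinearMap.integrable_comp f.integrable.comp_neg)

@[simp]
theorem refl_apply (f : FreqSpace d) (ξ : Space d) : refl f ξ = (starRingEnd ℂ) (f (-ξ)) := rfl

theorem refl_add (f g : FreqSpace d) : refl (f + g) = refl f + refl g := by ext ξ; simp

@[simp]
theorem l1Norm_refl (f : FreqSpace d) : l1Norm (refl f) = l1Norm f := by
  simp only [l1Norm_eq, refl_apply, RCLike.norm_conj]
  exact integral_neg_eq_self (fun ξ ↦ ‖f ξ‖) volume

@[simp]
theorem supNorm_refl (f : FreqSpace d) : supNorm (refl f) = supNorm f :=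
  le_antisymm (supNorm_mono fun ξ ↦ ⟨-ξ, by simp⟩) (supNorm_mono fun ξ ↦ ⟨-ξ, by simp⟩)

/-! ### The quintic nonlinearity -/

/-- The quintic form corresponding to `f₁ f̄₂ f₃ f̄₄ f₅` in physical space. -/
noncomputable def quint (f₁ f₂ f₃ f₄ f₅ : FreqSpace d) : FreqSpace d :=
  conv (conv (conv f₁ (refl f₂)) (conv f₃ (refl f₄))) f₅

/-- The nonlinearity `|u|⁴u` on the frequency side. -/
noncomputable def nonlin (f : FreqSpace d) : FreqSpace d := quint f f f f f

theorem nonlin_sub (f g : FreqSpace d) :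
    nonlin g - nonlin f = quint (g - f) g g g g + quint f (g - f) g g g +
      quint f f (g - f) g g + quint f f f (g - f) g + quint f f f f (g - f) := by
  obtain ⟨h, rfl⟩ : ∃ h, g = f + h := ⟨g - f, by abel⟩
  simp only [add_sub_cancel_left, nonlin, quint, conv_add_left, conv_add_right, refl_add]
  abel

theorem nonlin_add_sub_sub (a b : FreqSpace d) :
    nonlin (a + b) - nonlin b - nonlin a =
      (quint b a (a + b) (a + b) (a + b) + quint b b a (a + b) (a + b) +
        quint b b b a (a + b) + quint b b b b a) +
      (quint a b (a + b) (a + b) (a + b) + quint a a b (a + b) (a + b) +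
        quint a a a b (a + b) + quint a a a a b) := by
  simp only [nonlin, quint, conv_add_left, conv_add_right, refl_add]
  abel

/-- The seminorms that make `C₀ ∩ L¹` a module over the convolution algebra `L¹`, and that are
invariant under conjugation in physical space and under the free evolution. They satisfy all the
multilinear estimates with one factor in the seminorm and four factors in `L¹`. -/
structure IsConvSeminorm (N : Seminorm ℂ (FreqSpace d)) : Prop where
  conv_le : ∀ f g, N (conv f g) ≤ N f * l1Norm g
  map_refl : ∀ f, N (refl f) = N f
  map_evol : ∀ t f, N (evol t f) = N f

theorem isConvSeminorm_supNorm : IsConvSeminorm (supNorm (d := d)) :=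
  ⟨supNorm_conv_le, supNorm_refl, supNorm_evol⟩

theorem isConvSeminorm_l1Norm : IsConvSeminorm (l1Norm (d := d)) :=
  ⟨l1Norm_conv_le, l1Norm_refl, l1Norm_evol⟩

theorem isConvSeminorm_norm : IsConvSeminorm (normSeminorm ℂ (FreqSpace d)) where
  conv_le f g := by
    simp only [coe_normSeminorm, norm_eq, max_mul_of_nonneg _ _ (apply_nonneg l1Norm g)]
    exact max_le_max (supNorm_conv_le f g) (l1Norm_conv_le f g)
  map_refl f := by simp [norm_eq]
  map_evol := norm_evol

theorem seminorm_add_le_of_le (N : Seminorm ℂ (FreqSpace d)) {f g : FreqSpace d} {A B : ℝ}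
    (hf : N f ≤ A) (hg : N g ≤ B) : N (f + g) ≤ A + B :=
  (map_add_le_add N f g).trans (add_le_add hf hg)

theorem l1Norm_conv_refl_le {f g : FreqSpace d} {A B : ℝ} (hf : l1Norm f ≤ A)
    (hg : l1Norm g ≤ B) : l1Norm (conv f (refl g)) ≤ A * B :=
  (l1Norm_conv_le _ _).trans (mul_le_mul hf ((l1Norm_refl g).trans_le hg) (apply_nonneg _ _)
    ((apply_nonneg _ _).trans hf))

namespace IsConvSeminorm

variable {N : Seminorm ℂ (FreqSpace d)}

section Multilinear

variable {f₁ f₂ f₃ f₄ f₅ : FreqSpace d} {M₁ M₂ M₃ M₄ M₅ : ℝ}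

theorem conv_le_of_le_left (hN : IsConvSeminorm N) (h₁ : N f₁ ≤ M₁) (h₂ : l1Norm f₂ ≤ M₂) :
    N (conv f₁ f₂) ≤ M₁ * M₂ :=
  (hN.conv_le _ _).trans (mul_le_mul h₁ h₂ (apply_nonneg _ _) ((apply_nonneg _ _).trans h₁))

theorem conv_le_of_le_right (hN : IsConvSeminorm N) (h₁ : l1Norm f₁ ≤ M₁) (h₂ : N f₂ ≤ M₂) :
    N (conv f₁ f₂) ≤ M₁ * M₂ := by
  rw [conv_comm, mul_comm]
  exact hN.conv_le_of_le_left h₂ h₁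

theorem quint_le_first (hN : IsConvSeminorm N) (h₁ : N f₁ ≤ M₁) (h₂ : l1Norm f₂ ≤ M₂)
    (h₃ : l1Norm f₃ ≤ M₃) (h₄ : l1Norm f₄ ≤ M₄) (h₅ : l1Norm f₅ ≤ M₅) :
    N (quint f₁ f₂ f₃ f₄ f₅) ≤ M₁ * M₂ * (M₃ * M₄) * M₅ :=
  hN.conv_le_of_le_left (hN.conv_le_of_le_left
    (hN.conv_le_of_le_left h₁ ((l1Norm_refl f₂).trans_le h₂)) (l1Norm_conv_refl_le h₃ h₄)) h₅

theorem quint_le_second (hN : IsConvSeminorm N) (h₁ : l1Norm f₁ ≤ M₁) (h₂ : N f₂ ≤ M₂)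
    (h₃ : l1Norm f₃ ≤ M₃) (h₄ : l1Norm f₄ ≤ M₄) (h₅ : l1Norm f₅ ≤ M₅) :
    N (quint f₁ f₂ f₃ f₄ f₅) ≤ M₁ * M₂ * (M₃ * M₄) * M₅ :=
  hN.conv_le_of_le_left (hN.conv_le_of_le_left
    (hN.conv_le_of_le_right h₁ ((hN.map_refl f₂).trans_le h₂)) (l1Norm_conv_refl_le h₃ h₄)) h₅

theorem quint_le_third (hN : IsConvSeminorm N) (h₁ : l1Norm f₁ ≤ M₁) (h₂ : l1Norm f₂ ≤ M₂)
    (h₃ : N f₃ ≤ M₃) (h₄ : l1Norm f₄ ≤ M₄) (h₅ : l1Norm f₅ ≤ M₅) :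
    N (quint f₁ f₂ f₃ f₄ f₅) ≤ M₁ * M₂ * (M₃ * M₄) * M₅ :=
  hN.conv_le_of_le_left (hN.conv_le_of_le_right (l1Norm_conv_refl_le h₁ h₂)
    (hN.conv_le_of_le_left h₃ ((l1Norm_refl f₄).trans_le h₄))) h₅

theorem quint_le_fourth (hN : IsConvSeminorm N) (h₁ : l1Norm f₁ ≤ M₁) (h₂ : l1Norm f₂ ≤ M₂)
    (h₃ : l1Norm f₃ ≤ M₃) (h₄ : N f₄ ≤ M₄) (h₅ : l1Norm f₅ ≤ M₅) :
    N (quint f₁ f₂ f₃ f₄ f₅) ≤ M₁ * M₂ * (M₃ * M₄) * M₅ :=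
  hN.conv_le_of_le_left (hN.conv_le_of_le_right (l1Norm_conv_refl_le h₁ h₂)
    (hN.conv_le_of_le_right h₃ ((hN.map_refl f₄).trans_le h₄))) h₅

theorem quint_le_fifth (hN : IsConvSeminorm N) (h₁ : l1Norm f₁ ≤ M₁) (h₂ : l1Norm f₂ ≤ M₂)
    (h₃ : l1Norm f₃ ≤ M₃) (h₄ : l1Norm f₄ ≤ M₄) (h₅ : N f₅ ≤ M₅) :
    N (quint f₁ f₂ f₃ f₄ f₅) ≤ M₁ * M₂ * (M₃ * M₄) * M₅ :=
  hN.conv_le_of_le_right (isConvSeminorm_l1Norm.conv_le_of_le_left (l1Norm_conv_refl_le h₁ h₂)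
    (l1Norm_conv_refl_le h₃ h₄)) h₅

end Multilinear

theorem nonlin_le (hN : IsConvSeminorm N) {f : FreqSpace d} {M : ℝ} (hf : l1Norm f ≤ M) :
    N (nonlin f) ≤ M ^ 4 * N f :=
  (hN.quint_le_first le_rfl hf hf hf hf).trans_eq (by ring)

theorem nonlin_sub_le (hN : IsConvSeminorm N) {f g : FreqSpace d} {M : ℝ} (hf : l1Norm f ≤ M)
    (hg : l1Norm g ≤ M) : N (nonlin g - nonlin f) ≤ 5 * M ^ 4 * N (g - f) := by
  rw [nonlin_sub]
  have a₁ := hN.quint_le_first (f₁ := g - f) le_rfl hg hg hg hg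
  have a₂ := hN.quint_le_second (f₂ := g - f) hf le_rfl hg hg hg
  have a₃ := hN.quint_le_third (f₃ := g - f) hf hf le_rfl hg hg
  have a₄ := hN.quint_le_fourth (f₄ := g - f) hf hf hf le_rfl hg
  have a₅ := hN.quint_le_fifth (f₅ := g - f) hf hf hf hf le_rfl
  exact (seminorm_add_le_of_le N (seminorm_add_le_of_le N (seminorm_add_le_of_le N
    (seminorm_add_le_of_le N a₁ a₂) a₃) a₄) a₅).trans_eq (by ring)

theorem nonlin_sub_le_l1Norm (hN : IsConvSeminorm N) {f g : FreqSpace d} {M K : ℝ}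
    (hf : l1Norm f ≤ M) (hg : l1Norm g ≤ M) (hf' : N f ≤ K) (hg' : N g ≤ K) :
    N (nonlin g - nonlin f) ≤ 5 * (K * M ^ 3 * l1Norm (g - f)) := by
  rw [nonlin_sub]
  have a₁ := hN.quint_le_fifth (f₁ := g - f) le_rfl hg hg hg hg'
  have a₂ := hN.quint_le_first (f₂ := g - f) hf' le_rfl hg hg hg
  have a₃ := hN.quint_le_first (f₃ := g - f) hf' hf le_rfl hg hg
  have a₄ := hN.quint_le_first (f₄ := g - f) hf' hf hf le_rfl hg
  have a₅ := hN.quint_le_first (f₅ := g - f) hf' hf hf hf le_rfl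
  exact (seminorm_add_le_of_le N (seminorm_add_le_of_le N (seminorm_add_le_of_le N
    (seminorm_add_le_of_le N a₁ a₂) a₃) a₄) a₅).trans_eq (by ring)

theorem nonlin_add_sub_sub_le (hN : IsConvSeminorm N) {a b : FreqSpace d} {M P K : ℝ}
    (ha : l1Norm a ≤ M) (hab : l1Norm (a + b) ≤ M) (hb : l1Norm b ≤ P) (hPM : P ≤ M)
    (ha' : N a ≤ K) : N (nonlin (a + b) - nonlin b - nonlin a) ≤ 8 * (P * K * M ^ 3) := by
  have hbM := hb.trans hPM
  rw [nonlin_add_sub_sub]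
  have a₁ := hN.quint_le_second hb ha' hab hab hab
  have a₂ := hN.quint_le_third hb hbM ha' hab hab
  have a₃ := hN.quint_le_fourth hb hbM hbM ha' hab
  have a₄ := hN.quint_le_fifth hb hbM hbM hbM ha'
  have b₁ := hN.quint_le_first ha' hb hab hab hab
  have b₂ := hN.quint_le_first ha' ha hb hab hab
  have b₃ := hN.quint_le_first ha' ha ha hb hab
  have b₄ := hN.quint_le_first ha' ha ha ha hb
  exact (seminorm_add_le_of_le N
    (seminorm_add_le_of_le N (seminorm_add_le_of_le N (seminorm_add_le_of_le N a₁ a₂) a₃) a₄)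
    (seminorm_add_le_of_le N (seminorm_add_le_of_le N (seminorm_add_le_of_le N b₁ b₂) b₃) b₄)
    ).trans_eq (by ring)

end IsConvSeminorm

@[fun_prop]
theorem continuous_nonlin : Continuous (nonlin (d := d)) := by
  refine continuous_iff_continuousAt.2 fun f ↦ tendsto_iff_norm_sub_tendsto_zero.2 ?_
  have h : Tendsto (fun g : FreqSpace d ↦ 5 * (‖f‖ + 1) ^ 4 * ‖g - f‖) (𝓝 f) (𝓝 0) := by
    have h : Continuous fun g : FreqSpace d ↦ 5 * (‖f‖ + 1) ^ 4 * ‖g - f‖ := by fun_prop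
    simpa using h.tendsto f
  refine squeeze_zero' (Eventually.of_forall fun _ ↦ norm_nonneg _) ?_ h
  filter_upwards [Metric.closedBall_mem_nhds f one_pos] with g hg
  exact isConvSeminorm_norm.nonlin_sub_le (by linarith [f.l1Norm_le_norm])
    (by linarith [g.l1Norm_le_norm, norm_le_norm_add_const_of_dist_le (Metric.mem_closedBall.1 hg)])

/-! ### The interaction picture -/

/-- The vector field of the equation in the interaction picture, on the frequency side: if `u` is a
solution of the equation, then `z t = evol (-t) (û t)` satisfies `z' = field μ t z`. -/
noncomputable def field (μ t : ℝ) (z : FreqSpace d) : FreqSpace d :=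
  ((μ : ℂ) * Complex.I) • evol (-t) (nonlin (evol t z))

/-- `z` is a solution on `[0,T]` in the interaction picture, on the frequency side. -/
def IsProfile (μ T : ℝ) (z : ℝ → FreqSpace d) : Prop :=
  ∀ t ∈ Icc 0 T, HasDerivWithinAt z (field μ t (z t)) (Icc 0 T) t

theorem IsProfile.continuousOn {μ T : ℝ} {z : ℝ → FreqSpace d} (hz : IsProfile μ T z) :
    ContinuousOn z (Icc 0 T) := fun t ht ↦ (hz t ht).continuousWithinAt

theorem IsConvSeminorm.field_sub_le {N : Seminorm ℂ (FreqSpace d)} (hN : IsConvSeminorm N)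
    {μ t M : ℝ} {z w : FreqSpace d} (hz : l1Norm z ≤ M) (hw : l1Norm w ≤ M) :
    N (field μ t w - field μ t z) ≤ 5 * |μ| * M ^ 4 * N (w - z) := by
  have h := hN.nonlin_sub_le ((l1Norm_evol t z).trans_le hz) ((l1Norm_evol t w).trans_le hw)
  rw [← evol_sub, hN.map_evol] at h
  rw [field, field, ← smul_sub, ← evol_sub, map_smul_eq_mul, hN.map_evol]
  calc _ ≤ |μ| * (5 * M ^ 4 * N (w - z)) := by simpa using by gcongr
    _ = _ := by ring

theorem norm_field_le (μ t : ℝ) (z : FreqSpace d) : ‖field μ t z‖ ≤ |μ| * ‖z‖ ^ 5 := by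
  have h := isConvSeminorm_norm.nonlin_le (evol t z).l1Norm_le_norm
  rw [coe_normSeminorm, norm_evol, ← pow_succ] at h
  rw [field, norm_smul, norm_evol]
  simpa using mul_le_mul_of_nonneg_left h (abs_nonneg μ)

theorem continuous_field (μ : ℝ) (z : FreqSpace d) : Continuous fun t ↦ field μ t z :=
  (continuous_evol_prod.comp (continuous_neg.prodMk
    (continuous_nonlin.comp (continuous_evol z)))).const_smul ((μ : ℂ) * Complex.I)

theorem exists_isProfile {μ : ℝ} {f : FreqSpace d} {M T : ℝ} (hM : 0 ≤ M) (hT : 0 ≤ T)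
    (hf : ‖f‖ ≤ M) (hTM : 32 * (|μ| * T * M ^ 4) ≤ 1) :
    ∃ z : ℝ → FreqSpace d, z 0 = f ∧ IsProfile μ T z ∧ ∀ t ∈ Icc 0 T, ‖z t‖ ≤ 2 * M := by
  have hball : ∀ z ∈ Metric.closedBall f M, ‖z‖ ≤ 2 * M := fun z hz ↦ by
    linarith [norm_le_norm_add_const_of_dist_le (Metric.mem_closedBall.1 hz)]
  have hPL : IsPicardLindelof (field μ) (⟨0, left_mem_Icc.2 hT⟩ : Icc 0 T) f ⟨M, hM⟩ 0
      ⟨|μ| * (2 * M) ^ 5, by positivity⟩ ⟨5 * |μ| * (2 * M) ^ 4, by positivity⟩ := by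
    refine ⟨fun t _ ↦ LipschitzOnWith.of_dist_le_mul fun z hz w hw ↦ ?_,
      fun z _ ↦ (continuous_field μ z).continuousOn, fun t _ z hz ↦ ?_, ?_⟩
    · rw [dist_eq_norm, dist_eq_norm]
      exact isConvSeminorm_norm.field_sub_le (w.l1Norm_le_norm.trans (hball w hw))
        (z.l1Norm_le_norm.trans (hball z hz))
    · refine (norm_field_le μ t z).trans ?_
      change _ ≤ |μ| * (2 * M) ^ 5
      gcongr
      exact hball z hz
    · change |μ| * (2 * M) ^ 5 * max (T - 0) (0 - 0) ≤ M - 0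
      rw [sub_zero, sub_zero, sub_zero, max_eq_left hT]
      nlinarith
  obtain ⟨z, h₀, hb, hd⟩ := exists_hasDerivWithinAt_mem_closedBall hPL
  exact ⟨z, h₀, hd, fun t ht ↦ hball _ (hb t ht)⟩

/-! ### Comparison of two solutions -/

/-- Two solutions on `[0,T]` in the interaction picture, where `M` bounds `w` and `w - b` in `L¹`,
the smaller number `P` bounds `b`, and `T` is at most half the inverse of the Lipschitz constant of
the vector field on the ball of radius `M`. In the application `w` and `b` have the data `ψ + φ` and
`ψ`. -/
structure IsProfilePair (μ T M P : ℝ) (w b : ℝ → FreqSpace d) : Prop where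
  left : IsProfile μ T w
  right : IsProfile μ T b
  l1Norm_left_le : ∀ t ∈ Icc 0 T, l1Norm (w t) ≤ M
  l1Norm_right_le : ∀ t ∈ Icc 0 T, l1Norm (b t) ≤ P
  l1Norm_sub_le : ∀ t ∈ Icc 0 T, l1Norm (w t - b t) ≤ M
  le : P ≤ M
  short : 10 * (|μ| * T * M ^ 4) ≤ 1

theorem l1Norm_evol_sub_le {f : FreqSpace d} {Λ : ℝ} (hf : ∀ ξ, f ξ ≠ 0 → symbol ξ ≤ Λ) {t : ℝ}
    (ht : 0 ≤ t) : l1Norm (evol t f - f) ≤ t * Λ * l1Norm f := by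
  refine l1Norm_le_mul fun ξ ↦ ?_
  by_cases h : f ξ = 0
  · simp [h]
  · rw [sub_apply, evol_apply, ← sub_one_mul, norm_mul]
    refine mul_le_mul_of_nonneg_right ((norm_phase_sub_one_le t ξ).trans ?_) (norm_nonneg _)
    rw [abs_of_nonneg ht]
    exact mul_le_mul_of_nonneg_left (hf ξ h) ht

namespace IsProfilePair

variable {μ T M P K Λ t : ℝ} {w b : ℝ → FreqSpace d}

theorem l1Norm_right_le' (h : IsProfilePair μ T M P w b) (ht : t ∈ Icc 0 T) : l1Norm (b t) ≤ M :=
  (h.l1Norm_right_le t ht).trans h.le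

theorem hasDerivWithinAt_clm_sub (h : IsProfilePair μ T M P w b) {F : Type*}
    [NormedAddCommGroup F] [NormedSpace ℂ F] (L : FreqSpace d →L[ℂ] F) (ht : t ∈ Icc 0 T) :
    HasDerivWithinAt (fun r ↦ L (w r - b r)) (L (field μ t (w t) - field μ t (b t)))
      (Icc 0 T) t :=
  hasDerivWithinAt_clm_apply L ((h.left t ht).sub (h.right t ht))

theorem supNorm_sub_le (h : IsProfilePair μ T M P w b) (ht : t ∈ Icc 0 T) :
    supNorm (w t - b t) ≤ 2 * supNorm (w 0 - b 0) := by
  have hcont : ContinuousOn (fun t ↦ supNorm (w t - b t)) (Icc 0 T) :=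
    (toC0.continuous.comp_continuousOn (h.left.continuousOn.sub h.right.continuousOn)).norm
  obtain ⟨r, hr, hmax⟩ := isCompact_Icc.exists_isMaxOn ⟨t, ht⟩ hcont
  set S := supNorm (w r - b r)
  have hderiv : ∀ t ∈ Icc 0 T, supNorm (field μ t (w t) - field μ t (b t)) ≤ 5 * |μ| * M ^ 4 * S :=
    fun t ht ↦ (isConvSeminorm_supNorm.field_sub_le (h.l1Norm_right_le' ht)
      (h.l1Norm_left_le t ht)).trans (mul_le_mul_of_nonneg_left (hmax ht) (by positivity))
  have hdrift := norm_sub_sub_smul_le (c := 0) (fun t ht ↦ h.hasDerivWithinAt_clm_sub toC0 ht)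
    (fun t ht ↦ (congrArg norm (sub_zero _)).trans_le (hderiv t ht)) hr
  have hS : S ≤ supNorm (w 0 - b 0) + 5 * |μ| * M ^ 4 * S * T := by
    rw [smul_zero, sub_zero] at hdrift
    calc S ≤ supNorm (w 0 - b 0) + 5 * |μ| * M ^ 4 * S * r :=
          (norm_le_norm_add_norm_sub' _ _).trans (add_le_add_right hdrift _)
      _ ≤ _ := by gcongr; exact hr.2
  have hshort := mul_le_mul_of_nonneg_right h.short (apply_nonneg supNorm (w r - b r))
  linarith [show supNorm (w t - b t) ≤ S from hmax ht]

theorem l1Norm_sub_sub_le (h : IsProfilePair μ T M P w b) (ht : t ∈ Icc 0 T) :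
    l1Norm (w t - b t - (w 0 - b 0)) ≤ 5 * |μ| * M ^ 5 * T := by
  have hM : 0 ≤ M := (apply_nonneg _ _).trans (h.l1Norm_left_le t ht)
  have hderiv : ∀ t ∈ Icc 0 T, l1Norm (field μ t (w t) - field μ t (b t)) ≤ 5 * |μ| * M ^ 4 * M :=
    fun t ht ↦ (isConvSeminorm_l1Norm.field_sub_le (h.l1Norm_right_le' ht)
      (h.l1Norm_left_le t ht)).trans
        (mul_le_mul_of_nonneg_left (h.l1Norm_sub_le t ht) (by positivity))
  have hdrift := norm_sub_sub_smul_le (c := 0) (fun t ht ↦ h.hasDerivWithinAt_clm_sub toL1 ht)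
    (fun t ht ↦ (congrArg norm (sub_zero _)).trans_le (hderiv t ht)) ht
  rw [smul_zero, sub_zero, ← map_sub] at hdrift
  calc l1Norm (w t - b t - (w 0 - b 0)) ≤ 5 * |μ| * M ^ 4 * M * t := hdrift
    _ = 5 * |μ| * M ^ 5 * t := by ring
    _ ≤ _ := by gcongr; exact ht.2

theorem l1Norm_evol_sub_sub_le (h : IsProfilePair μ T M P w b)
    (hΛ : ∀ ξ, (w 0 - b 0) ξ ≠ 0 → symbol ξ ≤ Λ) (hΛ₀ : 0 ≤ Λ) (ht : t ∈ Icc 0 T) :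
    l1Norm (evol t (w t - b t) - (w 0 - b 0)) ≤ 5 * |μ| * M ^ 5 * T + T * Λ * M := by
  have hsplit : evol t (w t - b t) - (w 0 - b 0) =
      evol t (w t - b t - (w 0 - b 0)) + (evol t (w 0 - b 0) - (w 0 - b 0)) := by
    rw [evol_sub t (w t - b t)]; abel
  rw [hsplit]
  refine seminorm_add_le_of_le l1Norm ?_ ((l1Norm_evol_sub_le hΛ ht.1).trans ?_)
  · rw [l1Norm_evol]
    exact h.l1Norm_sub_sub_le ht
  · have h₀ := h.l1Norm_sub_le 0 ⟨le_rfl, ht.1.trans ht.2⟩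
    gcongr
    · exact mul_nonneg (ht.1.trans ht.2) hΛ₀
    · exact ht.2

end IsProfilePair

theorem field_sub_field_apply (μ t : ℝ) (z y φ : FreqSpace d) (ξ : Space d) :
    (field μ t z - field μ t y) ξ - μ * Complex.I * nonlin φ ξ = μ * Complex.I *
      (phase (-t) ξ * (nonlin (evol t (z - y) + evol t y) - nonlin (evol t y) -
          nonlin (evol t (z - y))) ξ +
        phase (-t) ξ * (nonlin (evol t (z - y)) - nonlin φ) ξ +
        (phase (-t) ξ - 1) * nonlin φ ξ) := by
  rw [evol_sub, sub_add_cancel]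
  simp only [field, sub_apply, smul_apply, evol_apply]
  ring

namespace IsProfilePair

variable {μ T M P K Λ t : ℝ} {w b : ℝ → FreqSpace d}

theorem norm_field_sub_field_sub_nonlin_le (h : IsProfilePair μ T M P w b)
    (hK : supNorm (w 0 - b 0) ≤ K) (hΛ : ∀ ξ, (w 0 - b 0) ξ ≠ 0 → symbol ξ ≤ Λ) {ξ : Space d}
    (hξ : symbol ξ ≤ Λ) (ht : t ∈ Icc 0 T) :
    ‖(field μ t (w t) - field μ t (b t)) ξ - μ * Complex.I * nonlin (w 0 - b 0) ξ‖ ≤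
      |μ| * (K * M ^ 3 * (16 * P + 50 * (|μ| * T * M ^ 5) + 11 * (T * Λ * M))) := by
  set φ := w 0 - b 0
  set a := evol t (w t - b t)
  set c := evol t (b t)
  have hT : 0 ≤ T := ht.1.trans ht.2
  have hM : 0 ≤ M := (apply_nonneg _ _).trans (h.l1Norm_left_le t ht)
  have hK₀ : 0 ≤ K := (apply_nonneg _ _).trans hK
  have hΛ₀ : 0 ≤ Λ := (symbol_nonneg ξ).trans hξ
  have hφM : l1Norm φ ≤ M := h.l1Norm_sub_le 0 ⟨le_rfl, hT⟩
  have haM : l1Norm a ≤ M := (l1Norm_evol t _).trans_le (h.l1Norm_sub_le t ht)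
  have haK : supNorm a ≤ 2 * K := by
    rw [supNorm_evol]
    exact (h.supNorm_sub_le ht).trans (by gcongr)
  have hac : l1Norm (a + c) ≤ M := by
    rw [show a + c = evol t (w t) by simp only [a, c, evol_sub, sub_add_cancel], l1Norm_evol]
    exact h.l1Norm_left_le t ht
  have hinter : supNorm (nonlin (a + c) - nonlin c - nonlin a) ≤ 8 * (P * (2 * K) * M ^ 3) :=
    isConvSeminorm_supNorm.nonlin_add_sub_sub_le haM hac
      ((l1Norm_evol t _).trans_le (h.l1Norm_right_le t ht)) h.le haK
  have hdrift : supNorm (nonlin a - nonlin φ) ≤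
      5 * (2 * K * M ^ 3 * (5 * |μ| * M ^ 5 * T + T * Λ * M)) := by
    refine (isConvSeminorm_supNorm.nonlin_sub_le_l1Norm hφM haM (hK.trans (by linarith))
      haK).trans ?_
    gcongr
    exact h.l1Norm_evol_sub_sub_le hΛ hΛ₀ ht
  have hosc : ‖phase (-t) ξ - 1‖ * ‖nonlin φ ξ‖ ≤ T * Λ * (M ^ 4 * K) := by
    gcongr
    · refine (norm_phase_sub_one_le (-t) ξ).trans ?_
      rw [abs_neg, abs_of_nonneg ht.1]
      exact mul_le_mul ht.2 hξ (symbol_nonneg ξ) hT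
    · refine (norm_apply_le _ ξ).trans ((isConvSeminorm_supNorm.nonlin_le hφM).trans ?_)
      gcongr
  rw [field_sub_field_apply, norm_mul, norm_mul, Complex.norm_I, mul_one, Complex.norm_real,
    Real.norm_eq_abs]
  refine mul_le_mul_of_nonneg_left (norm_add₃_le.trans ?_) (abs_nonneg μ)
  simp only [norm_mul, norm_phase, one_mul]
  linarith [(norm_apply_le _ ξ).trans hinter, (norm_apply_le _ ξ).trans hdrift]

theorem norm_sub_sub_nonlin_le (h : IsProfilePair μ T M P w b) (hT : 0 ≤ T)
    (hK : supNorm (w 0 - b 0) ≤ K) (hΛ : ∀ ξ, (w 0 - b 0) ξ ≠ 0 → symbol ξ ≤ Λ) {ξ : Space d}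
    (hξ : symbol ξ ≤ Λ) :
    ‖(w T - b T) ξ - (w 0 - b 0) ξ - T * (μ * Complex.I * nonlin (w 0 - b 0) ξ)‖ ≤
      |μ| * (K * M ^ 3 * (16 * P + 50 * (|μ| * T * M ^ 5) + 11 * (T * Λ * M))) * T :=
  norm_sub_sub_smul_le (fun _ ht ↦ h.hasDerivWithinAt_clm_sub (evalCLM ξ) ht)
    (fun _ ht ↦ h.norm_field_sub_field_sub_nonlin_le hK hΛ hξ ht) (right_mem_Icc.2 hT)

end IsProfilePair

/-- A continuous function with compact support as an element of `C₀ ∩ L¹`. -/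
noncomputable def ofCompactSupport (f : Space d → ℂ) (hc : Continuous f)
    (hs : HasCompactSupport f) : FreqSpace d :=
  of f hc hs.is_zero_at_infty (hc.integrable_of_hasCompactSupport hs)

@[simp]
theorem ofCompactSupport_apply {f : Space d → ℂ} (hc : Continuous f) (hs : HasCompactSupport f)
    (ξ : Space d) : ofCompactSupport f hc hs ξ = f ξ := rfl

/-! ### Lower bounds for convolutions -/

/-- The volume of the unit ball. -/
noncomputable def ballVol (d : ℕ) : ℝ := volume.real (Metric.ball (0 : Space d) 1)

theorem ballVol_pos : 0 < ballVol d :=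
  ENNReal.toReal_pos (Metric.measure_ball_pos _ _ one_pos).ne' measure_ball_lt_top.ne

theorem volume_real_ball (x : Space d) {r : ℝ} (hr : 0 < r) :
    volume.real (Metric.ball x r) = r ^ d * ballVol d := by
  rw [measureReal_def, Measure.addHaar_ball_of_pos _ _ hr, ENNReal.toReal_mul, ballVol,
    measureReal_def, ENNReal.toReal_ofReal (by positivity), finrank_euclideanSpace_fin]

/-- `f` is real and nonnegative everywhere, and at least `α` on the ball of radius `r` around `η`.
Positivity rules out any cancellation in convolutions of such functions. -/
def MinorizedOn (f : FreqSpace d) (η : Space d) (r α : ℝ) : Prop :=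
  ∃ g : Space d → ℝ, (∀ ξ, f ξ = g ξ) ∧ (∀ ξ, 0 ≤ g ξ) ∧ ∀ ξ ∈ Metric.ball η r, α ≤ g ξ

namespace MinorizedOn

variable {f f₁ f₂ : FreqSpace d} {η η₁ η₂ : Space d} {r α α₁ α₂ : ℝ}

theorem le_norm {ξ : Space d} (h : MinorizedOn f η r α) (hξ : ξ ∈ Metric.ball η r) :
    α ≤ ‖f ξ‖ := by
  obtain ⟨g, hg, hg₀, hgα⟩ := h
  rw [hg, Complex.norm_real, Real.norm_of_nonneg (hg₀ ξ)]
  exact hgα ξ hξ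

theorem refl (h : MinorizedOn f η r α) : MinorizedOn (FreqSpace.refl f) (-η) r α := by
  obtain ⟨g, hg, hg₀, hgα⟩ := h
  refine ⟨fun ξ ↦ g (-ξ), fun ξ ↦ by simp [hg], fun ξ ↦ hg₀ _, fun ξ hξ ↦ hgα _ ?_⟩
  rwa [Metric.mem_ball, ← dist_neg_neg, neg_neg]

theorem conv (h₁ : MinorizedOn f₁ η₁ r α₁) (h₂ : MinorizedOn f₂ η₂ r α₂) (hr : 0 < r)
    (hα₂ : 0 ≤ α₂) :
    MinorizedOn (FreqSpace.conv f₁ f₂) (η₁ + η₂) r (α₁ * α₂ * ((r / 2) ^ d * ballVol d)) := by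
  obtain ⟨g₁, hg₁, hp₁, hl₁⟩ := h₁
  obtain ⟨g₂, hg₂, hp₂, hl₂⟩ := h₂
  have hint : ∀ ξ, Integrable fun η ↦ g₁ η * g₂ (ξ - η) := fun ξ ↦ by
    simpa [hg₁, hg₂] using (f₁.integrable_conv_integrand f₂ ξ).re
  refine ⟨fun ξ ↦ ∫ η, g₁ η * g₂ (ξ - η), fun ξ ↦ ?_,
    fun ξ ↦ integral_nonneg fun η ↦ mul_nonneg (hp₁ _) (hp₂ _), fun ξ hξ ↦ ?_⟩
  · rw [conv_apply, ← integral_complex_ofReal]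
    simp [hg₁, hg₂]
  · obtain ⟨v, rfl⟩ : ∃ v, ξ = η₁ + η₂ + (2 : ℝ) • v :=
      ⟨(1 / 2 : ℝ) • (ξ - (η₁ + η₂)), by rw [smul_smul]; norm_num⟩
    have hv : ‖v‖ < r / 2 := by
      rw [mem_ball_iff_norm, add_sub_cancel_left, norm_smul, Real.norm_two] at hξ
      linarith
    have hmem : ∀ η ∈ Metric.ball (η₁ + v) (r / 2),
        η ∈ Metric.ball η₁ r ∧ η₁ + η₂ + (2 : ℝ) • v - η ∈ Metric.ball η₂ r := fun η hη ↦ by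
      rw [mem_ball_iff_norm] at hη ⊢
      rw [mem_ball_iff_norm, show η - η₁ = η - (η₁ + v) + v by abel,
        show η₁ + η₂ + (2 : ℝ) • v - η - η₂ = v - (η - (η₁ + v)) by rw [two_smul]; abel]
      exact ⟨(norm_add_le _ _).trans_lt (by linarith), (norm_sub_le _ _).trans_lt (by linarith)⟩
    calc α₁ * α₂ * ((r / 2) ^ d * ballVol d)
        = ∫ _ in Metric.ball (η₁ + v) (r / 2), α₁ * α₂ := by
          rw [setIntegral_const, volume_real_ball _ (by positivity), smul_eq_mul, mul_comm]
      _ ≤ ∫ η in Metric.ball (η₁ + v) (r / 2), g₁ η * g₂ (η₁ + η₂ + (2 : ℝ) • v - η) :=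
          setIntegral_mono_on (integrableOn_const measure_ball_lt_top.ne) (hint _).integrableOn
            measurableSet_ball fun η hη ↦
              mul_le_mul (hl₁ η (hmem η hη).1) (hl₂ _ (hmem η hη).2) hα₂ (hp₁ _)
      _ ≤ ∫ η, g₁ η * g₂ (η₁ + η₂ + (2 : ℝ) • v - η) :=
          setIntegral_le_integral (hint _)
            (Eventually.of_forall fun η ↦ mul_nonneg (hp₁ _) (hp₂ _))

/-- The resonance `η - 2η + η - 2η + 2η = 0` moves mass from high to low frequencies. -/
theorem nonlin (h₁ : MinorizedOn f η r α) (h₂ : MinorizedOn f ((2 : ℝ) • η) r α) (hr : 0 < r)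
    (hα : 0 ≤ α) :
    MinorizedOn (FreqSpace.nonlin f) 0 r (α ^ 5 * ((r / 2) ^ d * ballVol d) ^ 4) := by
  have hv : 0 ≤ (r / 2) ^ d * ballVol d := mul_nonneg (by positivity) ballVol_pos.le
  have h₃ := h₁.conv h₂.refl hr hα
  have h₄ := (h₃.conv h₃ hr (by positivity)).conv h₂ hr hα
  convert h₄ using 1
  · rfl
  · module
  · ring

end MinorizedOn

/-! ### The high-frequency perturbation -/

/-- The tent of height and radius `A` around `η` (zero if `A ≤ 0`). -/
noncomputable def tent (A : ℝ) (η : Space d) : FreqSpace d :=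
  ofCompactSupport (fun ξ ↦ ((max 0 (A - ‖ξ - η‖) : ℝ) : ℂ)) (by fun_prop)
    (HasCompactSupport.intro (isCompact_closedBall η A) fun ξ hξ ↦ by
      rw [mem_closedBall_iff_norm, not_le] at hξ
      rw [max_eq_left (by linarith), Complex.ofReal_zero])

theorem tent_apply (A : ℝ) (η ξ : Space d) :
    tent A η ξ = ((max 0 (A - ‖ξ - η‖) : ℝ) : ℂ) := rfl

theorem tent_eq_zero {A : ℝ} {η ξ : Space d} (h : A ≤ ‖ξ - η‖) : tent A η ξ = 0 := by
  rw [tent_apply, max_eq_left (sub_nonpos.2 h), Complex.ofReal_zero]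

theorem norm_tent_apply_le {A : ℝ} (hA : 0 ≤ A) (η ξ : Space d) : ‖tent A η ξ‖ ≤ A := by
  rw [tent_apply, Complex.norm_real, Real.norm_of_nonneg (le_max_left _ _)]
  exact max_le hA (sub_le_self _ (norm_nonneg _))

theorem l1Norm_tent_le {A : ℝ} (hA : 0 < A) (η : Space d) :
    l1Norm (tent A η) ≤ A * (A ^ d * ballVol d) := by
  rw [l1Norm_eq, ← setIntegral_eq_integral_of_forall_compl_eq_zero (s := Metric.ball η A),
    ← volume_real_ball η hA]
  · refine (setIntegral_mono (tent A η).integrable.norm.integrableOn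
      (integrableOn_const measure_ball_lt_top.ne) (norm_tent_apply_le hA.le η)).trans_eq ?_
    rw [setIntegral_const, smul_eq_mul, mul_comm]
  · intro ξ hξ
    rw [mem_ball_iff_norm, not_lt] at hξ
    rw [tent_eq_zero hξ, norm_zero]

/-- The perturbation of the data: two tents of height `R` and radius `A` around the frequencies `η`
and `2η`. -/
noncomputable def twoTents (R A : ℝ) (η : Space d) : FreqSpace d :=
  ((R / A : ℝ) : ℂ) • (tent A η + tent A ((2 : ℝ) • η))

section TwoTents

variable {R A N : ℝ} {η ξ : Space d}

theorem twoTents_apply (R A : ℝ) (η ξ : Space d) : twoTents R A η ξ =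
    ((R / A * (max 0 (A - ‖ξ - η‖) + max 0 (A - ‖ξ - (2 : ℝ) • η‖)) : ℝ) : ℂ) := by
  rw [twoTents, smul_apply, add_apply, tent_apply, tent_apply]
  push_cast
  rfl

theorem supNorm_twoTents_le (hR : 0 ≤ R) (hA : 0 < A) (η : Space d) :
    supNorm (twoTents R A η) ≤ 2 * R := by
  refine supNorm_le (by positivity) fun ξ ↦ ?_
  calc ‖twoTents R A η ξ‖ ≤ R / A * (A + A) := by
        rw [twoTents, smul_apply, norm_mul, Complex.norm_real, Real.norm_of_nonneg (by positivity)]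
        gcongr
        exact norm_add_le_of_le (norm_tent_apply_le hA.le _ _) (norm_tent_apply_le hA.le _ _)
    _ = 2 * R := by field_simp; ring

theorem l1Norm_twoTents_le (hR : 0 ≤ R) (hA : 0 < A) (η : Space d) :
    l1Norm (twoTents R A η) ≤ 2 * ballVol d * (R * A ^ d) := by
  rw [twoTents, map_smul_eq_mul, Complex.norm_real, Real.norm_of_nonneg (by positivity)]
  calc R / A * l1Norm (tent A η + tent A ((2 : ℝ) • η))
      ≤ R / A * (A * (A ^ d * ballVol d) + A * (A ^ d * ballVol d)) := by
        gcongr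
        exact seminorm_add_le_of_le l1Norm (l1Norm_tent_le hA _) (l1Norm_tent_le hA _)
    _ = 2 * ballVol d * (R * A ^ d) := by field_simp; ring

theorem minorizedOn_twoTents (hR : 0 ≤ R) (hA : 0 < A) (η : Space d) :
    MinorizedOn (twoTents R A η) η (A / 2) (R / 2) ∧
      MinorizedOn (twoTents R A η) ((2 : ℝ) • η) (A / 2) (R / 2) := by
  have hpos : ∀ ζ ξ : Space d, 0 ≤ max 0 (A - ‖ξ - ζ‖) := fun _ _ ↦ le_max_left _ _
  have hhalf : ∀ ζ : Space d, ∀ ξ ∈ Metric.ball ζ (A / 2), A / 2 ≤ max 0 (A - ‖ξ - ζ‖) := by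
    intro ζ ξ hξ
    rw [mem_ball_iff_norm] at hξ
    exact le_max_of_le_right (by linarith)
  have hscale : R / 2 = R / A * (A / 2) := by field_simp
  have hnonneg : ∀ ξ, 0 ≤ R / A * (max 0 (A - ‖ξ - η‖) + max 0 (A - ‖ξ - (2 : ℝ) • η‖)) := by
    intro ξ; positivity
  refine ⟨⟨_, twoTents_apply R A η, hnonneg, fun ξ hξ ↦ ?_⟩,
    ⟨_, twoTents_apply R A η, hnonneg, fun ξ hξ ↦ ?_⟩⟩ <;> rw [hscale] <;> gcongr
  · exact le_add_of_le_of_nonneg (hhalf _ ξ hξ) (hpos _ ξ)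
  · exact le_add_of_nonneg_of_le (hpos _ ξ) (hhalf _ ξ hξ)

theorem le_norm_nonlin_twoTents (hR : 0 ≤ R) (hA : 0 < A) (η : Space d)
    (hξ : ξ ∈ Metric.ball 0 (A / 2)) :
    (1 / 2) ^ 5 * ((1 / 4) ^ d * ballVol d) ^ 4 * (R * (R * A ^ d) ^ 4) ≤
      ‖nonlin (twoTents R A η) ξ‖ := by
  obtain ⟨h₁, h₂⟩ := minorizedOn_twoTents hR hA η
  refine le_of_eq_of_le ?_ ((h₁.nonlin h₂ (by positivity) (by positivity)).le_norm hξ)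
  rw [show A / 2 / 2 = 1 / 4 * A by ring, mul_pow (1 / 4 : ℝ) A d]
  ring

theorem mem_ball_of_twoTents_ne_zero (h : twoTents R A η ξ ≠ 0) :
    ξ ∈ Metric.ball η A ∪ Metric.ball ((2 : ℝ) • η) A := by
  contrapose! h
  simp only [mem_union, mem_ball_iff_norm, not_or, not_lt] at h
  rw [twoTents, smul_apply, add_apply, tent_eq_zero h.1, tent_eq_zero h.2, add_zero, mul_zero]

theorem norm_mem_Icc_of_twoTents_ne_zero (hη : ‖η‖ = N) (hA : 4 * A ≤ N)
    (h : twoTents R A η ξ ≠ 0) : ‖ξ‖ ∈ Icc (N / 2) (3 * N) := by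
  have h₂η : ‖(2 : ℝ) • η‖ = 2 * N := by rw [norm_smul, hη, Real.norm_two]
  have hN : 0 ≤ N := hη ▸ norm_nonneg η
  rcases mem_ball_of_twoTents_ne_zero h with hξ | hξ <;> rw [mem_ball_iff_norm] at hξ <;>
    have hdist := abs_le.1 ((abs_norm_sub_norm_le _ _).trans hξ.le) <;>
    constructor <;> linarith

end TwoTents

theorem symbol_le_of_norm_le {ξ : Space d} {N : ℝ} (h : ‖ξ‖ ≤ 3 * N) :
    symbol ξ ≤ (6 * Real.pi) ^ 4 * N ^ 4 := by
  rw [symbol, ← mul_pow]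
  refine pow_le_pow_left₀ (by positivity) ?_ 4
  linarith [mul_le_mul_of_nonneg_left h Real.two_pi_pos.le]

/-! ### Growth at low frequencies -/

theorem exists_isProfilePair {μ T M : ℝ} {ψ φ : FreqSpace d} (hψφ : ‖ψ + φ‖ ≤ M) (hψ : ‖ψ‖ ≤ M)
    (hT : 0 ≤ T) (hshort : 10 * (|μ| * T * (4 * M) ^ 4) ≤ 1) :
    ∃ w b : ℝ → FreqSpace d, w 0 = ψ + φ ∧ b 0 = ψ ∧ (∀ t ∈ Icc 0 T, ‖b t‖ ≤ 2 * ‖ψ‖) ∧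
      IsProfilePair μ T (4 * M) (2 * ‖ψ‖) w b := by
  have hM : 0 ≤ M := (norm_nonneg _).trans hψ
  have hTM : 32 * (|μ| * T * M ^ 4) ≤ 1 := by
    have : 0 ≤ |μ| * T * M ^ 4 := by positivity
    linarith
  have hTψ : 32 * (|μ| * T * ‖ψ‖ ^ 4) ≤ 1 := le_trans (by gcongr) hTM
  obtain ⟨w, hw₀, hw, hwM⟩ := exists_isProfile hM hT hψφ hTM
  obtain ⟨b, hb₀, hb, hbψ⟩ := exists_isProfile (norm_nonneg ψ) hT le_rfl hTψ
  refine ⟨w, b, hw₀, hb₀, hbψ, hw, hb, fun t ht ↦ ?_, fun t ht ↦ ?_, fun t ht ↦ ?_, by linarith,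
    hshort⟩
  · linarith [l1Norm_le_norm (w t), hwM t ht]
  · exact (l1Norm_le_norm _).trans (hbψ t ht)
  · linarith [l1Norm_le_norm (w t - b t), norm_sub_le (w t) (b t), hwM t ht, hbψ t ht]

/-- The constraints on the height `R` and the radius `A` of two tents at frequencies of size `N`
under which their effect on the solution can be computed up to time `δ / N⁴`. -/
structure IsTentScale (d : ℕ) (N A R : ℝ) : Prop where
  one_le_radius : 1 ≤ A
  four_mul_radius_le : 4 * A ≤ N
  height_pos : 0 < R
  mass_le : R * A ^ d ≤ N

namespace IsTentScale

variable {N A R : ℝ}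

theorem radius_pos (h : IsTentScale d N A R) : 0 < A := one_pos.trans_le h.one_le_radius

theorem freq_pos (h : IsTentScale d N A R) : 0 < N := by
  linarith [h.radius_pos, h.four_mul_radius_le]

theorem mass_pos (h : IsTentScale d N A R) : 0 < R * A ^ d :=
  mul_pos h.height_pos (pow_pos h.radius_pos d)

theorem height_le_mass (h : IsTentScale d N A R) : R ≤ R * A ^ d :=
  le_mul_of_one_le_right h.height_pos.le (one_le_pow₀ h.one_le_radius)

theorem norm_twoTents_le (h : IsTentScale d N A R) (η : Space d) :
    ‖twoTents R A η‖ ≤ (2 * ballVol d + 2) * (R * A ^ d) := by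
  have hv : 0 ≤ ballVol d * (R * A ^ d) := mul_nonneg ballVol_pos.le h.mass_pos.le
  rw [norm_eq]
  refine max_le ((supNorm_twoTents_le h.height_pos.le h.radius_pos η).trans ?_)
    ((l1Norm_twoTents_le h.height_pos.le h.radius_pos η).trans ?_) <;>
    linarith [h.height_le_mass, h.mass_pos]

end IsTentScale

theorem duhamel_error_le {m G L δ T N X R P : ℝ} (hm : 0 ≤ m) (hG : 0 ≤ G) (hT : 0 ≤ T)
    (hX : 0 ≤ X) (hR : 0 ≤ R) (hXN : X ≤ N) (hTN : T * N ^ 4 = δ) (hP : P ≤ 2 * δ * X) :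
    m * (2 * R * (G * X) ^ 3 *
      (16 * P + 50 * (m * T * (G * X) ^ 5) + 11 * (T * (L * N ^ 4) * (G * X)))) * T ≤
      2 * m * G ^ 3 * (32 + 50 * m * G ^ 5 + 11 * L * G) * δ * (T * (R * X ^ 4)) := by
  have hTX : T * X ^ 4 ≤ δ := hTN ▸ by gcongr
  have hself : m * T * (G * X) ^ 5 ≤ m * δ * G ^ 5 * X := by
    calc m * T * (G * X) ^ 5 = m * (T * X ^ 4) * G ^ 5 * X := by ring
      _ ≤ _ := by gcongr
  have hlin : T * (L * N ^ 4) * (G * X) = L * δ * G * X := by rw [← hTN]; ring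
  calc _ ≤ m * (2 * R * (G * X) ^ 3 *
        (16 * (2 * δ * X) + 50 * (m * δ * G ^ 5 * X) + 11 * (L * δ * G * X))) * T := by
        rw [hlin]; gcongr
    _ = _ := by ring

theorem exists_isProfilePair_twoTents {μ δ T C N A R : ℝ} (h : IsTentScale d N A R)
    (hδ : δ ≤ 1) (hT : 0 ≤ T) (hTN : T * N ^ 4 = δ) (hC : 2 * ballVol d + 3 ≤ C)
    (hδC : 10 * (|μ| * (4 * C) ^ 4) * δ ≤ 1) (η : Space d) {ψ : FreqSpace d}
    (hψ : ‖ψ‖ ≤ δ * (R * A ^ d)) :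
    ∃ w b : ℝ → FreqSpace d, w 0 = ψ + twoTents R A η ∧ b 0 = ψ ∧
      (∀ t ∈ Icc 0 T, ‖b t‖ ≤ 2 * ‖ψ‖) ∧
      IsProfilePair μ T (4 * (C * (R * A ^ d))) (2 * ‖ψ‖) w b := by
  have hX := h.mass_pos
  set X := R * A ^ d
  have hψX : ‖ψ‖ ≤ X := hψ.trans (mul_le_of_le_one_left hX.le hδ)
  have hψC : ‖ψ‖ ≤ C * X :=
    hψX.trans (le_mul_of_one_le_left hX.le (by linarith [ballVol_pos (d := d)]))
  have hψφ : ‖ψ + twoTents R A η‖ ≤ C * X := by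
    calc ‖ψ + twoTents R A η‖ ≤ X + (2 * ballVol d + 2) * X :=
          norm_add_le_of_le hψX (h.norm_twoTents_le η)
      _ = (2 * ballVol d + 3) * X := by ring
      _ ≤ C * X := by gcongr
  refine exists_isProfilePair hψφ hψC hT ?_
  calc 10 * (|μ| * T * (4 * (C * X)) ^ 4) = 10 * (|μ| * (4 * C) ^ 4) * (T * X ^ 4) := by ring
    _ ≤ 10 * (|μ| * (4 * C) ^ 4) * (T * N ^ 4) := by gcongr; exact h.mass_le
    _ ≤ 1 := by rwa [hTN]

theorem exists_duhamel_expansion (d : ℕ) (μ : ℝ) : ∃ δ₀ D : ℝ, 0 < δ₀ ∧ 0 ≤ D ∧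
    ∀ δ ∈ Ioc 0 δ₀, ∀ {N A R : ℝ}, IsTentScale d N A R → ∀ {η : Space d} {ψ : FreqSpace d},
      ‖η‖ = N → ‖ψ‖ ≤ δ * (R * A ^ d) →
      ∃ w b : ℝ → FreqSpace d, w 0 = ψ + twoTents R A η ∧ IsProfile μ (δ / N ^ 4) w ∧
        ‖b (δ / N ^ 4)‖ ≤ 2 * ‖ψ‖ ∧ ∀ ξ ∈ Metric.ball (0 : Space d) (A / 2),
          ‖(w (δ / N ^ 4) - b (δ / N ^ 4)) ξ -
              (δ / N ^ 4 : ℝ) * (μ * Complex.I * nonlin (twoTents R A η) ξ)‖ ≤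
            D * δ * (δ / N ^ 4 * (R * (R * A ^ d) ^ 4)) := by
  set C := 2 * ballVol d + 3
  have hC : 0 < C := by linarith [ballVol_pos (d := d)]
  refine ⟨1 / (10 * (|μ| * (4 * C) ^ 4) + 1), 2 * |μ| * (4 * C) ^ 3 *
    (32 + 50 * |μ| * (4 * C) ^ 5 + 11 * (6 * Real.pi) ^ 4 * (4 * C)), by positivity, by positivity,
    fun δ ⟨hδ₀, hδ⟩ N A R h η ψ hη hψ ↦ ?_⟩
  have hN := h.freq_pos
  set T := δ / N ^ 4
  have hT : 0 < T := div_pos hδ₀ (by positivity)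
  have hTN : T * N ^ 4 = δ := div_mul_cancel₀ _ (by positivity)
  have hδC : 10 * (|μ| * (4 * C) ^ 4) * δ + δ ≤ 1 := by
    linarith [(le_div_iff₀ (by positivity)).1 hδ]
  have hδ₁ : 0 ≤ 10 * (|μ| * (4 * C) ^ 4) * δ := by positivity
  obtain ⟨w, b, hw₀, hb₀, hb, hwb⟩ := exists_isProfilePair_twoTents (μ := μ) h (by linarith) hT.le
    hTN le_rfl (by linarith) η hψ
  have hφ : w 0 - b 0 = twoTents R A η := by rw [hw₀, hb₀, add_sub_cancel_left]
  refine ⟨w, b, hw₀, hwb.left, hb T (right_mem_Icc.2 hT.le), fun ξ hξ ↦ ?_⟩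
  have hξN : ‖ξ‖ < N / 2 := by
    linarith [mem_ball_zero_iff.1 hξ, h.four_mul_radius_le, h.radius_pos]
  have hφξ : twoTents R A η ξ = 0 := by
    by_contra hne
    exact hξN.not_ge (norm_mem_Icc_of_twoTents_ne_zero hη h.four_mul_radius_le hne).1
  have hexp := hwb.norm_sub_sub_nonlin_le hT.le (K := 2 * R) (Λ := (6 * Real.pi) ^ 4 * N ^ 4)
    (by rw [hφ]; exact supNorm_twoTents_le h.height_pos.le h.radius_pos η)
    (fun ζ hζ ↦ symbol_le_of_norm_le
      (norm_mem_Icc_of_twoTents_ne_zero hη h.four_mul_radius_le (hφ ▸ hζ)).2)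
    (symbol_le_of_norm_le (ξ := ξ) (by linarith))
  rw [hφ, hφξ, sub_zero, ← mul_assoc 4 C] at hexp
  exact hexp.trans (duhamel_error_le (abs_nonneg μ) (by positivity) hT.le h.mass_pos.le
    h.height_pos.le h.mass_le hTN (by linarith))

theorem exists_growth (d : ℕ) {μ : ℝ} (hμ : μ ≠ 0) : ∃ δ κ : ℝ, 0 < δ ∧ 0 < κ ∧
    ∀ {N A R : ℝ}, IsTentScale d N A R → ∀ {η : Space d} {ψ : FreqSpace d},
      ‖η‖ = N → ‖ψ‖ ≤ δ * (R * A ^ d) →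
      ∃ w b : ℝ → FreqSpace d, w 0 = ψ + twoTents R A η ∧ IsProfile μ (δ / N ^ 4) w ∧
        ‖b (δ / N ^ 4)‖ ≤ 2 * ‖ψ‖ ∧ ∀ ξ ∈ Metric.ball (0 : Space d) (A / 2),
          κ * (R * A ^ d / N) ^ 4 * R ≤ ‖(w (δ / N ^ 4) - b (δ / N ^ 4)) ξ‖ := by
  obtain ⟨δ₀, D, hδ₀, hD, hexp⟩ := exists_duhamel_expansion d μ
  set c : ℝ := (1 / 2) ^ 5 * ((1 / 4) ^ d * ballVol d) ^ 4
  have hc : 0 < |μ| * c := by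
    have := ballVol_pos (d := d); positivity
  set δ := min δ₀ (|μ| * c / (2 * (D + 1)))
  have hδ : 0 < δ := lt_min hδ₀ (by positivity)
  have hDδ : D * δ ≤ |μ| * c / 2 := by
    have := (le_div_iff₀ (by positivity)).1 (min_le_right δ₀ (|μ| * c / (2 * (D + 1))))
    linarith
  refine ⟨δ, δ * (|μ| * c / 2), hδ, by positivity, fun {N A R} h {η ψ} hη hψ ↦ ?_⟩
  obtain ⟨w, b, hw₀, hw, hb, herr⟩ := hexp δ ⟨hδ, min_le_left _ _⟩ h hη hψ
  refine ⟨w, b, hw₀, hw, hb, fun ξ hξ ↦ ?_⟩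
  set T := δ / N ^ 4
  have hT : 0 < T := div_pos hδ (pow_pos h.freq_pos 4)
  have hmass : 0 ≤ T * (R * (R * A ^ d) ^ 4) := by
    have := h.height_pos; have := h.radius_pos; positivity
  have hmain : |μ| * c * (T * (R * (R * A ^ d) ^ 4)) ≤
      ‖(T : ℂ) * (μ * Complex.I * nonlin (twoTents R A η) ξ)‖ := by
    rw [norm_mul, norm_mul, norm_mul, Complex.norm_I, mul_one, Complex.norm_real, Complex.norm_real,
      Real.norm_of_nonneg hT.le, Real.norm_eq_abs]
    calc |μ| * c * (T * (R * (R * A ^ d) ^ 4)) = T * (|μ| * (c * (R * (R * A ^ d) ^ 4))) := by ring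
      _ ≤ _ := by gcongr; exact le_norm_nonlin_twoTents h.height_pos.le h.radius_pos η hξ
  calc δ * (|μ| * c / 2) * (R * A ^ d / N) ^ 4 * R
      = |μ| * c / 2 * (T * (R * (R * A ^ d) ^ 4)) := by rw [div_pow]; ring
    _ ≤ |μ| * c * (T * (R * (R * A ^ d) ^ 4)) - D * δ * (T * (R * (R * A ^ d) ^ 4)) := by
      linarith [mul_le_mul_of_nonneg_right hDδ hmass]
    _ ≤ _ := by
      refine (sub_le_sub hmain (herr ξ hξ)).trans ?_
      rw [sub_le_iff_le_add]
      exact norm_le_norm_add_norm_sub _ _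

end FreqSpace

/-! ### Physical space -/

theorem toDistribution_apply {d : ℕ} (f : Space d →ᵇ ℂ) (φ : 𝓢(Space d, ℂ)) :
    toDistribution f φ = ∫ x, φ x * f x := by
  rw [toDistribution, Lp.toTemperedDistribution_apply]
  refine integral_congr_ae ?_
  filter_upwards [(f.memLp_top (μ := volume)).coeFn_toLp] with x hx
  rw [hx, smul_eq_mul]

theorem toDistribution_sub {d : ℕ} (f g : Space d →ᵇ ℂ) :
    toDistribution (f - g) = toDistribution f - toDistribution g := by
  rw [toDistribution, toDistribution, toDistribution, ← Lp.toTemperedDistributionCLM_apply,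
    ← Lp.toTemperedDistributionCLM_apply, ← Lp.toTemperedDistributionCLM_apply, ← map_sub]
  rfl

namespace FreqSpace

variable {d : ℕ}

theorem continuous_neg_innerₗ :
    Continuous fun p : Space d × Space d ↦ (-innerₗ (Space d)) p.1 p.2 := by
  simp only [LinearMap.neg_apply, innerₗ_apply_apply]
  fun_prop

/-- The bounded continuous function with Fourier transform `f`. -/
noncomputable def toPhys (f : FreqSpace d) : Space d →ᵇ ℂ :=
  BoundedContinuousFunction.ofNormedAddCommGroup (𝓕⁻ (f : Space d → ℂ))
    (VectorFourier.fourierIntegral_continuous Real.continuous_fourierChar continuous_neg_innerₗ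
      f.integrable)
    (l1Norm f) (fun _ ↦ (VectorFourier.norm_fourierIntegral_le_integral_norm _ _ _ _ _).trans_eq
      (l1Norm_eq f).symm)

theorem toPhys_apply (f : FreqSpace d) (x : Space d) : toPhys f x = 𝓕⁻ (f : Space d → ℂ) x := rfl

theorem toPhys_sub (f g : FreqSpace d) : toPhys (f - g) = toPhys f - toPhys g := by
  ext x
  rw [BoundedContinuousFunction.sub_apply]
  simp only [toPhys_apply, Real.fourierInv_eq, sub_apply, smul_sub]
  exact integral_sub ((Real.fourierIntegral_convergent_iff (-x)).2 f.integrable |>.congr (by simp))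
    ((Real.fourierIntegral_convergent_iff (-x)).2 g.integrable |>.congr (by simp))

theorem toPhys_conv (f g : FreqSpace d) : toPhys (conv f g) = toPhys f * toPhys g := by
  ext x
  rw [BoundedContinuousFunction.mul_apply]
  simp only [toPhys_apply, Real.fourierInv_eq_fourier_neg, coe_conv]
  exact Real.fourier_mul_convolution_eq f.integrable g.integrable (-x)

theorem toPhys_refl (f : FreqSpace d) (x : Space d) :
    toPhys (refl f) x = (starRingEnd ℂ) (toPhys f x) := by
  simp only [toPhys_apply, Real.fourierInv_eq, refl_apply]
  rw [← integral_conj, ← integral_neg_eq_self]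
  refine integral_congr_ae (Eventually.of_forall fun ξ ↦ ?_)
  simp [Circle.smul_def, AddChar.map_neg_eq_inv]

theorem quintic_toPhys (f : FreqSpace d) : quintic (toPhys f) = toPhys (nonlin f) := by
  ext x
  simp only [nonlin, quint, toPhys_conv, BoundedContinuousFunction.mul_apply, toPhys_refl,
    Complex.mul_conj']
  change ((‖toPhys f x‖ ^ 4 : ℝ) : ℂ) * toPhys f x = _
  push_cast
  ring

theorem toDistribution_toPhys_apply (f : FreqSpace d) (φ : 𝓢(Space d, ℂ)) :
    toDistribution (toPhys f) φ = ∫ ξ, (𝓕⁻ φ) ξ * f ξ := by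
  have hflip : (-innerₗ (Space d)).flip = -innerₗ (Space d) := by
    ext x y; simp [real_inner_comm]
  have h := VectorFourier.integral_fourierIntegral_smul_eq_flip (μ := volume) (ν := volume)
    (f := φ) (g := f) Real.continuous_fourierChar continuous_neg_innerₗ φ.integrable f.integrable
  rw [hflip] at h
  rw [toDistribution_apply, SchwartzMap.fourierInv_coe]
  exact h.symm

theorem fourier_toDistribution_toPhys_apply (f : FreqSpace d) (φ : 𝓢(Space d, ℂ)) :
    𝓕 (toDistribution (toPhys f)) φ = ∫ ξ, φ ξ * f ξ := by
  rw [TemperedDistribution.fourier_apply, toDistribution_toPhys_apply,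
    FourierTransform.fourierInv_fourier_eq]

theorem toDistribution_toPhys_sub (f g : FreqSpace d) :
    toDistribution (toPhys f) - toDistribution (toPhys g) = toDistribution (toPhys (f - g)) := by
  rw [toPhys_sub, toDistribution_sub]

/-! ### The equation -/

theorem fourierInv_laplacian (φ : 𝓢(Space d, ℂ)) (ξ : Space d) :
    (𝓕⁻ (Δ φ)) ξ = ((-(2 * Real.pi * ‖ξ‖) ^ 2 : ℝ) : ℂ) * (𝓕⁻ φ) ξ := by
  have hneg : ∀ ψ : 𝓢(Space d, ℂ), (𝓕⁻ ψ) ξ = (𝓕 ψ) (-ξ) := fun ψ ↦ by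
    rw [SchwartzMap.fourierInv_coe, SchwartzMap.fourier_coe, Real.fourierInv_eq_fourier_neg]
  have hg : (fun ξ : Space d ↦ ‖ξ‖ ^ 2).HasTemperateGrowth := by fun_prop
  rw [hneg, hneg, SchwartzMap.laplacian_eq_fourierMultiplierCLM,
    SchwartzMap.fourierMultiplierCLM_apply, FourierTransform.fourier_smul,
    FourierTransform.fourier_fourierInv_eq, _root_.smul_apply,
    SchwartzMap.smulLeftCLM_apply_apply hg]
  simp only [norm_neg, Complex.real_smul]
  push_cast
  ring

theorem fourierInv_laplacian_laplacian (φ : 𝓢(Space d, ℂ)) (ξ : Space d) :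
    (𝓕⁻ (Δ (Δ φ))) ξ = (symbol ξ : ℂ) * (𝓕⁻ φ) ξ := by
  rw [fourierInv_laplacian, fourierInv_laplacian, symbol]
  push_cast
  ring

theorem integrable_mul_coe (k : Space d →ᵇ ℂ) (f : FreqSpace d) :
    Integrable fun ξ ↦ k ξ * f ξ :=
  f.integrable.bdd_mul k.continuous.aestronglyMeasurable (Eventually.of_forall k.norm_coe_le_norm)

/-- The pairing `∫ k f` of bounded continuous functions with `C₀ ∩ L¹`. -/
noncomputable def pairing (d : ℕ) : (Space d →ᵇ ℂ) →L[ℂ] FreqSpace d →L[ℂ] ℂ :=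
  LinearMap.mkContinuous₂
    (LinearMap.mk₂ ℂ (fun k f ↦ ∫ ξ, k ξ * f ξ)
      (fun k₁ k₂ f ↦ by
        simp only [BoundedContinuousFunction.add_apply, add_mul]
        exact integral_add (integrable_mul_coe k₁ f) (integrable_mul_coe k₂ f))
      (fun c k f ↦ by
        simp only [BoundedContinuousFunction.smul_apply, smul_eq_mul, mul_assoc]
        exact integral_const_mul _ _)
      (fun k f g ↦ by
        simp only [add_apply, mul_add]
        exact integral_add (integrable_mul_coe k f) (integrable_mul_coe k g))
      (fun c k f ↦ by
        simp only [smul_apply, smul_eq_mul, mul_left_comm _ c]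
        exact integral_const_mul _ _))
    1 (fun k f ↦ by
      rw [one_mul]
      refine le_trans ?_ (mul_le_mul_of_nonneg_left f.l1Norm_le_norm (norm_nonneg k))
      rw [l1Norm_eq, ← integral_const_mul]
      refine norm_integral_le_of_norm_le (f.integrable.norm.const_mul _)
        (Eventually.of_forall fun ξ ↦ ?_)
      rw [norm_mul]
      exact mul_le_mul_of_nonneg_right (k.norm_coe_le_norm ξ) (norm_nonneg _))

theorem pairing_apply (k : Space d →ᵇ ℂ) (f : FreqSpace d) : pairing d k f = ∫ ξ, k ξ * f ξ := rfl

theorem norm_symbol_pow_mul_le (χ : 𝓢(Space d, ℂ)) (n : ℕ) (ξ : Space d) :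
    ‖(symbol ξ : ℂ) ^ n * χ ξ‖ ≤ (2 * Real.pi) ^ (4 * n) * SchwartzMap.seminorm ℂ (4 * n) 0 χ := by
  rw [norm_mul, norm_pow, Complex.norm_real, Real.norm_of_nonneg (symbol_nonneg ξ), symbol,
    ← pow_mul, mul_pow, mul_assoc]
  gcongr
  exact SchwartzMap.norm_pow_mul_le_seminorm ℂ χ (4 * n) ξ

/-- The function `symbolⁿ · χ · phase t` for a Schwartz function `χ`. Its derivative in `t`
corresponds to `n ↦ n + 1`. -/
noncomputable def phasedTest (χ : 𝓢(Space d, ℂ)) (n : ℕ) (t : ℝ) : Space d →ᵇ ℂ :=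
  BoundedContinuousFunction.ofNormedAddCommGroup (fun ξ ↦ (symbol ξ : ℂ) ^ n * χ ξ * phase t ξ)
    (by fun_prop) ((2 * Real.pi) ^ (4 * n) * SchwartzMap.seminorm ℂ (4 * n) 0 χ) (fun ξ ↦ by
      rw [norm_mul, norm_phase, mul_one]
      exact norm_symbol_pow_mul_le χ n ξ)

theorem phasedTest_apply (χ : 𝓢(Space d, ℂ)) (n : ℕ) (t : ℝ) (ξ : Space d) :
    phasedTest χ n t ξ = (symbol ξ : ℂ) ^ n * χ ξ * phase t ξ := rfl

theorem norm_exp_ofReal_mul_I_sub_one_sub_le (x : ℝ) :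
    ‖Complex.exp (x * Complex.I) - 1 - x * Complex.I‖ ≤ 3 * x ^ 2 := by
  have hx : ‖(x : ℂ) * Complex.I‖ = |x| := by simp
  rcases le_or_gt |x| 1 with h | h
  · refine (Complex.norm_exp_sub_one_sub_id_le (by rwa [hx])).trans ?_
    rw [hx, sq_abs]
    linarith [sq_nonneg x]
  · have h₁ : ‖Complex.exp (x * Complex.I) - 1‖ ≤ |x| := by
      rw [mul_comm]; exact Real.norm_exp_I_mul_ofReal_sub_one_le
    refine (norm_sub_le _ _).trans ?_
    rw [hx]
    nlinarith [sq_abs x]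

theorem norm_phase_sub_sub_le (r t : ℝ) (ξ : Space d) :
    ‖phase r ξ - phase t ξ - (r - t) * (Complex.I * symbol ξ * phase t ξ)‖ ≤
      3 * (symbol ξ ^ 2 * (r - t) ^ 2) := by
  have h : phase r ξ = phase t ξ * Complex.exp (((r - t) * symbol ξ : ℝ) * Complex.I) := by
    rw [← phase, ← phase_add]; ring_nf
  have hfactor : phase r ξ - phase t ξ - (r - t) * (Complex.I * symbol ξ * phase t ξ) =
      phase t ξ * (Complex.exp (((r - t) * symbol ξ : ℝ) * Complex.I) - 1 -
        ((r - t) * symbol ξ : ℝ) * Complex.I) := by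
    rw [h]
    push_cast
    ring
  rw [hfactor, norm_mul, norm_phase, one_mul]
  exact (norm_exp_ofReal_mul_I_sub_one_sub_le _).trans_eq (by ring)

theorem hasDerivAt_phasedTest (χ : 𝓢(Space d, ℂ)) (t : ℝ) :
    HasDerivAt (phasedTest χ 0) (Complex.I • phasedTest χ 1 t) t := by
  set C := (2 * Real.pi) ^ (4 * 2) * SchwartzMap.seminorm ℂ (4 * 2) 0 χ
  have hremainder : ∀ r, ‖phasedTest χ 0 r - phasedTest χ 0 t -
      (r - t) • Complex.I • phasedTest χ 1 t‖ ≤ 3 * C * ‖(r - t) ^ 2‖ := fun r ↦ by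
    refine (BoundedContinuousFunction.norm_le (by positivity)).2 fun ξ ↦ ?_
    have hC := norm_symbol_pow_mul_le χ 2 ξ
    rw [norm_mul, norm_pow, Complex.norm_real, Real.norm_of_nonneg (symbol_nonneg ξ)] at hC
    calc _ = ‖χ ξ‖ * ‖phase r ξ - phase t ξ - (r - t) * (Complex.I * symbol ξ * phase t ξ)‖ := by
          rw [← norm_mul]
          simp only [BoundedContinuousFunction.sub_apply, BoundedContinuousFunction.smul_apply,
            phasedTest_apply, smul_eq_mul, Complex.real_smul]
          push_cast
          ring_nf
      _ ≤ ‖χ ξ‖ * (3 * (symbol ξ ^ 2 * (r - t) ^ 2)) := by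
          gcongr; exact norm_phase_sub_sub_le r t ξ
      _ = 3 * (symbol ξ ^ 2 * ‖χ ξ‖) * (r - t) ^ 2 := by ring
      _ ≤ _ := by rw [Real.norm_of_nonneg (sq_nonneg _)]; gcongr
  rw [hasDerivAt_iff_isLittleO]
  refine (Asymptotics.IsBigO.of_bound _ (Eventually.of_forall hremainder)).trans_isLittleO ?_
  have hlim : Tendsto (fun r ↦ r - t) (𝓝 t) (𝓝 0) := by
    simpa using (continuous_sub_right t).tendsto t
  exact ((Asymptotics.isLittleO_pow_id one_lt_two).comp_tendsto hlim :)

/-- The solution in physical space belonging to a solution in the interaction picture. -/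
noncomputable def solution (z : ℝ → FreqSpace d) (t : ℝ) : Space d →ᵇ ℂ := toPhys (evol t (z t))

theorem toDistribution_solution_apply (z : ℝ → FreqSpace d) (t : ℝ) (φ : 𝓢(Space d, ℂ)) :
    toDistribution (solution z t) φ = pairing d (phasedTest (𝓕⁻ φ) 0 t) (z t) := by
  rw [solution, toDistribution_toPhys_apply, pairing_apply]
  simp only [phasedTest_apply, evol_apply, pow_zero, one_mul, mul_assoc]

theorem pairing_field (μ t : ℝ) (z : ℝ → FreqSpace d) (φ : 𝓢(Space d, ℂ)) :
    pairing d (phasedTest (𝓕⁻ φ) 0 t) (field μ t (z t)) =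
      Complex.I * μ * toDistribution (quintic (solution z t)) φ := by
  rw [solution, quintic_toPhys, toDistribution_toPhys_apply, pairing_apply, ← integral_const_mul]
  refine integral_congr_ae (Eventually.of_forall fun ξ ↦ ?_)
  have hp : phase t ξ * phase (-t) ξ = 1 := by rw [← phase_add, add_neg_cancel, phase_zero]
  simp only [phasedTest_apply, field, smul_apply, evol_apply, pow_zero, one_mul]
  linear_combination (𝓕⁻ φ) ξ * Complex.I * μ * nonlin (evol t (z t)) ξ * hp

theorem pairing_phasedTest_one (t : ℝ) (z : ℝ → FreqSpace d) (φ : 𝓢(Space d, ℂ)) :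
    pairing d (phasedTest (𝓕⁻ φ) 1 t) (z t) = Δ (Δ (toDistribution (solution z t))) φ := by
  rw [TemperedDistribution.laplacian_apply_apply, TemperedDistribution.laplacian_apply_apply,
    solution, toDistribution_toPhys_apply, pairing_apply]
  simp only [phasedTest_apply, pow_one, fourierInv_laplacian_laplacian, evol_apply, mul_assoc]

theorem hasDerivWithinAt_toDistribution_solution {μ T : ℝ} {z : ℝ → FreqSpace d}
    (hz : IsProfile μ T z) {t : ℝ} (ht : t ∈ Icc 0 T) (φ : 𝓢(Space d, ℂ)) :
    HasDerivWithinAt (fun r ↦ toDistribution (solution z r) φ)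
      ((Complex.I • Δ (Δ (toDistribution (solution z t))) +
        (Complex.I * μ) • toDistribution (quintic (solution z t))) φ) (Icc 0 T) t := by
  simp only [toDistribution_solution_apply]
  refine (ContinuousLinearMap.hasDerivWithinAt_of_bilinear
    (B := (pairing d).bilinearRestrictScalars ℝ)
    (hasDerivAt_phasedTest (𝓕⁻ φ) t).hasDerivWithinAt (hz t ht)).congr_deriv ?_
  simp only [ContinuousLinearMap.bilinearRestrictScalars_apply_apply, map_smul,
    _root_.smul_apply, pairing_field, pairing_phasedTest_one]
  exact add_comm _ _

/-! ### Sobolev norms -/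

/-- The weight `⟨ξ⟩^s`. -/
noncomputable def weight (s : ℝ) (ξ : Space d) : ℝ := (1 + ‖ξ‖ ^ 2) ^ (s / 2)

theorem weight_pos (s : ℝ) (ξ : Space d) : 0 < weight s ξ := by unfold weight; positivity

theorem weight_le_one {s : ℝ} (hs : s ≤ 0) (ξ : Space d) : weight s ξ ≤ 1 :=
  Real.rpow_le_one_of_one_le_of_nonpos (by nlinarith [sq_nonneg ‖ξ‖]) (by linarith)

theorem weight_le_rpow {s : ℝ} (hs : s ≤ 0) {r : ℝ} (hr : 0 < r) {ξ : Space d} (hξ : r ≤ ‖ξ‖) :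
    weight s ξ ≤ r ^ s := by
  have h : (r ^ 2) ^ (s / 2) = r ^ s := by
    rw [← Real.rpow_natCast, ← Real.rpow_mul hr.le, Nat.cast_ofNat, mul_div_cancel₀ s two_ne_zero]
  rw [← h, weight]
  exact Real.rpow_le_rpow_of_nonpos (by positivity) (by nlinarith) (by linarith)

theorem weight_sq (s : ℝ) (ξ : Space d) : weight s ξ ^ 2 = (1 + ‖ξ‖ ^ 2) ^ s := by
  rw [weight, ← Real.rpow_natCast, ← Real.rpow_mul (by positivity), Nat.cast_ofNat,
    div_mul_cancel₀ s two_ne_zero]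

theorem le_weight_sq {s r : ℝ} (hs : s ≤ 0) (hr : 1 ≤ r) {ξ : Space d} (hξ : ‖ξ‖ ≤ r) :
    (2 * r ^ 2) ^ s ≤ weight s ξ ^ 2 := by
  rw [weight_sq]
  exact Real.rpow_le_rpow_of_nonpos (by positivity) (by nlinarith [norm_nonneg ξ]) hs

theorem continuous_weight (s : ℝ) : Continuous (weight (d := d) s) :=
  Continuous.rpow_const (by fun_prop) fun ξ ↦ Or.inl (by positivity)

/-- The function `⟨ξ⟩^s f`. -/
noncomputable def weighted (s : ℝ) (f : FreqSpace d) (ξ : Space d) : ℂ := weight s ξ * f ξ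

theorem weighted_add (s : ℝ) (f g : FreqSpace d) :
    weighted s (f + g) = weighted s f + weighted s g := by
  ext ξ; simp [weighted, mul_add]

theorem weighted_sub (s : ℝ) (f g : FreqSpace d) :
    weighted s (f - g) = weighted s f - weighted s g := by
  ext ξ; simp [weighted, mul_sub]

theorem norm_weighted_apply (s : ℝ) (f : FreqSpace d) (ξ : Space d) :
    ‖weighted s f ξ‖ = weight s ξ * ‖f ξ‖ := by
  rw [weighted, norm_mul, Complex.norm_real, Real.norm_of_nonneg (weight_pos s ξ).le]

theorem aestronglyMeasurable_weighted (s : ℝ) (f : FreqSpace d) :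
    AEStronglyMeasurable (weighted s f) volume :=
  ((Complex.continuous_ofReal.comp (continuous_weight s)).mul f.continuous_coe).aestronglyMeasurable

theorem eLpNorm_weighted_evol (s t : ℝ) (f : FreqSpace d) :
    eLpNorm (weighted s (evol t f)) 2 volume = eLpNorm (weighted s f) 2 volume :=
  eLpNorm_congr_norm_ae (Eventually.of_forall fun ξ ↦ by simp [weighted])

theorem eLpNorm_two_sq (g : Space d → ℂ) : eLpNorm g 2 volume ^ 2 = ∫⁻ ξ, ‖g ξ‖ₑ ^ 2 := by
  simpa using eLpNorm_nnreal_pow_eq_lintegral (f := g) (μ := volume) (p := 2) two_ne_zero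

theorem eLpNorm_two_le (f : FreqSpace d) :
    eLpNorm (f : Space d → ℂ) 2 volume ≤ ENNReal.ofReal ‖f‖ := by
  refine (ENNReal.pow_le_pow_left_iff two_ne_zero).1 ?_
  calc eLpNorm (f : Space d → ℂ) 2 volume ^ 2 = ∫⁻ ξ, ‖f ξ‖ₑ ^ 2 := eLpNorm_two_sq _
    _ ≤ ∫⁻ ξ, ENNReal.ofReal ‖f‖ * ‖f ξ‖ₑ := by
        refine lintegral_mono fun ξ ↦ ?_
        rw [sq]
        gcongr
        rw [← ofReal_norm]
        exact ENNReal.ofReal_le_ofReal ((f.norm_apply_le ξ).trans (le_max_left _ _))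
    _ = ENNReal.ofReal ‖f‖ * ENNReal.ofReal (l1Norm f) := by
        rw [lintegral_const_mul' _ _ ENNReal.ofReal_ne_top, l1Norm_eq,
          ofReal_integral_norm_eq_lintegral_enorm f.integrable]
    _ ≤ ENNReal.ofReal ‖f‖ ^ 2 := by rw [sq]; gcongr; exact f.l1Norm_le_norm

theorem eLpNorm_weighted_le {s : ℝ} (hs : s ≤ 0) (f : FreqSpace d) :
    eLpNorm (weighted s f) 2 volume ≤ ENNReal.ofReal ‖f‖ := by
  refine (eLpNorm_mono fun ξ ↦ ?_).trans f.eLpNorm_two_le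
  rw [norm_weighted_apply]
  exact mul_le_of_le_one_left (norm_nonneg _) (weight_le_one hs ξ)

theorem memLp_weighted {s : ℝ} (hs : s ≤ 0) (f : FreqSpace d) : MemLp (weighted s f) 2 volume :=
  ⟨aestronglyMeasurable_weighted s f, (eLpNorm_weighted_le hs f).trans_lt ENNReal.ofReal_lt_top⟩

/-- The function `g` represents the distribution `⟨ξ⟩^s 𝓕D`. -/
def IsWeightedFourier (s : ℝ) {p : ℝ≥0∞} [Fact (1 ≤ p)] (D : 𝓢'(Space d, ℂ))
    (g : Lp ℂ p (volume : Measure (Space d))) : Prop :=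
  smulLeftCLM ℂ (fun ξ : Space d ↦ (((1 + ‖ξ‖ ^ 2) ^ (s / 2) : ℝ) : ℂ)) (𝓕 D) =
    (g : 𝓢'(Space d, ℂ))

theorem IsWeightedFourier.sub {s : ℝ} {p : ℝ≥0∞} [Fact (1 ≤ p)] {D D' : 𝓢'(Space d, ℂ)}
    {g g' : Lp ℂ p (volume : Measure (Space d))} (h : IsWeightedFourier s D g)
    (h' : IsWeightedFourier s D' g') : IsWeightedFourier s (D - D') (g - g') := by
  rw [IsWeightedFourier, ← FourierTransform.fourierCLM_apply (R := ℂ), map_sub, map_sub,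
    FourierTransform.fourierCLM_apply, FourierTransform.fourierCLM_apply, h, h',
    ← Lp.toTemperedDistributionCLM_apply, ← Lp.toTemperedDistributionCLM_apply,
    ← Lp.toTemperedDistributionCLM_apply, map_sub]

theorem isWeightedFourier_toPhys {s : ℝ} {p : ℝ≥0∞} [Fact (1 ≤ p)] {f : FreqSpace d}
    {g : Lp ℂ p (volume : Measure (Space d))} (hg : g =ᵐ[volume] weighted s f) :
    IsWeightedFourier s (toDistribution (toPhys f)) g := by
  ext φ
  rw [smulLeftCLM_apply_apply, fourier_toDistribution_toPhys_apply, Lp.toTemperedDistribution_apply]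
  refine integral_congr_ae ?_
  filter_upwards [hg] with ξ hξ
  rw [hξ, SchwartzMap.smulLeftCLM_apply_apply (by fun_prop), smul_eq_mul, smul_eq_mul, weighted,
    weight]
  ring

theorem fl1Norm_toPhys_le (f : FreqSpace d) :
    fl1Norm (toDistribution (toPhys f)) ≤ ENNReal.ofReal ‖f‖ := by
  refine (iInf₂_le (toL1 f) (isWeightedFourier_toPhys ?_)).trans ?_
  · filter_upwards [f.coe_ae] with ξ hξ
    rw [weighted, weight, zero_div, Real.rpow_zero, Complex.ofReal_one, one_mul]
    exact hξ
  · rw [← ofReal_norm]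
    exact ENNReal.ofReal_le_ofReal f.l1Norm_le_norm

theorem IsWeightedFourier.sobolevNorm_eq {s : ℝ} {D : 𝓢'(Space d, ℂ)}
    {g : Lp ℂ 2 (volume : Measure (Space d))} (h : IsWeightedFourier s D g) :
    sobolevNorm s D = ‖g‖ₑ := by
  refine le_antisymm (iInf₂_le g h) (le_iInf₂ fun g' h' ↦ ?_)
  have hinj := LinearMap.ker_eq_bot.1
    (Lp.ker_toTemperedDistributionCLM_eq_bot (F := ℂ) (μ := (volume : Measure (Space d))) (p := 2))
  rw [hinj (h.symm.trans h')]

theorem sobolevNorm_toPhys {s : ℝ} (hs : s ≤ 0) (f : FreqSpace d) :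
    sobolevNorm s (toDistribution (toPhys f)) = eLpNorm (weighted s f) 2 volume := by
  rw [(isWeightedFourier_toPhys (memLp_weighted hs f).coeFn_toLp).sobolevNorm_eq, Lp.enorm_toLp]

theorem sobolevNorm_toPhys_sub {s : ℝ} (hs : s ≤ 0) (f : FreqSpace d) {D : 𝓢'(Space d, ℂ)}
    {g : Lp ℂ 2 (volume : Measure (Space d))} (hg : IsWeightedFourier s D g) :
    sobolevNorm s (toDistribution (toPhys f) - D) =
      eLpNorm (weighted s f - (g : Space d → ℂ)) 2 volume := by
  have hf := (memLp_weighted hs f).coeFn_toLp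
  rw [((isWeightedFourier_toPhys hf).sub hg).sobolevNorm_eq, Lp.enorm_def]
  exact eLpNorm_congr_ae ((Lp.coeFn_sub _ g).trans (hf.sub EventuallyEq.rfl))

theorem sobolevNorm_toPhys_add_sub_le {s : ℝ} (hs : s ≤ 0) (f φ : FreqSpace d)
    {D : 𝓢'(Space d, ℂ)} (hD : MemSobolev s 2 D) :
    sobolevNorm s (toDistribution (toPhys (f + φ)) - D) ≤
      sobolevNorm s (toDistribution (toPhys f) - D) + eLpNorm (weighted s φ) 2 volume := by
  obtain ⟨g, hg⟩ := memSobolev_iff_exists_smulLeftCLM_fourier.1 hD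
  rw [sobolevNorm_toPhys_sub hs _ hg, sobolevNorm_toPhys_sub hs _ hg, weighted_add,
    add_sub_right_comm]
  exact eLpNorm_add_le ((aestronglyMeasurable_weighted s f).sub (Lp.aestronglyMeasurable g))
    (aestronglyMeasurable_weighted s φ) one_le_two

theorem exists_sobolevNorm_toPhys_sub_le {s : ℝ} (hs : s ≤ 0) {D : 𝓢'(Space d, ℂ)}
    (hD : MemSobolev s 2 D) {ε : ℝ} (hε : 0 < ε) :
    ∃ ψ : FreqSpace d, sobolevNorm s (toDistribution (toPhys ψ) - D) ≤ ENNReal.ofReal ε := by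
  obtain ⟨g, hg⟩ := memSobolev_iff_exists_smulLeftCLM_fourier.1 hD
  obtain ⟨h, hsupp, hle, hcont, -⟩ := (Lp.memLp g).exists_hasCompactSupport_eLpNorm_sub_le
    ENNReal.ofNat_ne_top (ENNReal.ofReal_pos.2 hε).ne'
  have hweight : ∀ ξ : Space d, (weight s ξ : ℂ) ≠ 0 := fun ξ ↦
    Complex.ofReal_ne_zero.2 (weight_pos s ξ).ne'
  have hψ : Continuous fun ξ : Space d ↦ (weight s ξ : ℂ)⁻¹ * h ξ :=
    ((Complex.continuous_ofReal.comp (continuous_weight s)).inv₀ hweight).mul hcont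
  have hψh : weighted s (ofCompactSupport _ hψ hsupp.mul_left) = h := by
    ext ξ
    rw [weighted, ofCompactSupport_apply, mul_inv_cancel_left₀ (hweight ξ)]
  refine ⟨ofCompactSupport _ hψ hsupp.mul_left, ?_⟩
  rwa [sobolevNorm_toPhys_sub hs _ hg, hψh, eLpNorm_sub_comm]

theorem continuousInNorm_solution {n : 𝓢'(Space d, ℂ) → ℝ≥0∞}
    (hn : ∀ f : FreqSpace d, n (toDistribution (toPhys f)) ≤ ENNReal.ofReal ‖f‖) {μ T : ℝ}
    {z : ℝ → FreqSpace d} (hz : IsProfile μ T z) : ContinuousInNorm n T (solution z) := by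
  intro t ht
  refine ⟨(hn _).trans_lt ENNReal.ofReal_lt_top, ?_⟩
  have hcont : ContinuousOn (fun t ↦ evol t (z t)) (Icc 0 T) :=
    continuous_evol_prod.comp_continuousOn (g := fun p : ℝ × FreqSpace d ↦ evol p.1 p.2)
      (f := fun t ↦ (t, z t)) (continuousOn_id.prodMk hz.continuousOn)
  have hlim := (ENNReal.continuous_ofReal.tendsto 0).comp
    (tendsto_iff_norm_sub_tendsto_zero.1 (hcont t ht))
  rw [ENNReal.ofReal_zero] at hlim
  refine tendsto_of_tendsto_of_tendsto_of_le_of_le tendsto_const_nhds hlim (fun _ ↦ zero_le)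
    fun r ↦ ?_
  simp only [solution, toDistribution_toPhys_sub]
  exact hn _

theorem isSolution_solution {μ s T : ℝ} (hs : s ≤ 0) {z : ℝ → FreqSpace d}
    (hz : IsProfile μ T z) : IsSolution μ s T (solution z) where
  continuous_fl1 := continuousInNorm_solution fl1Norm_toPhys_le hz
  continuous_sobolev := continuousInNorm_solution
    (fun f ↦ (sobolevNorm_toPhys hs f).trans_le (eLpNorm_weighted_le hs f)) hz
  equation t ht := by
    refine ⟨_, hasDerivWithinAt_toDistribution_solution hz ht, ?_⟩
    rw [smul_add, smul_smul, smul_smul, ← mul_assoc, Complex.I_mul_I, neg_one_mul]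
    simp only [neg_smul, one_smul]
    abel

theorem sobolevNorm_solution {s : ℝ} (hs : s ≤ 0) (z : ℝ → FreqSpace d) (t : ℝ) :
    sobolevNorm s (toDistribution (solution z t)) = eLpNorm (weighted s (z t)) 2 volume := by
  rw [solution, sobolevNorm_toPhys hs, eLpNorm_weighted_evol]

/-! ### Norm inflation -/

/-- The square of the `L²` norm of `⟨ξ⟩^s` over the ball of radius `r`. -/
noncomputable def lowMass (d : ℕ) (s r : ℝ) : ℝ :=
  ∫ ξ in Metric.ball (0 : Space d) r, weight s ξ ^ 2

theorem integrableOn_weight_sq (s : ℝ) (x : Space d) (r : ℝ) :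
    IntegrableOn (fun ξ ↦ weight s ξ ^ 2) (Metric.ball x r) :=
  (((continuous_weight s).pow 2).continuousOn.integrableOn_compact
    (isCompact_closedBall x r)).mono_set Metric.ball_subset_closedBall

theorem lowMass_nonneg (d : ℕ) (s r : ℝ) : 0 ≤ lowMass d s r :=
  integral_nonneg fun _ ↦ sq_nonneg _

theorem le_eLpNorm_weighted (s : ℝ) {f : FreqSpace d} {c r : ℝ} (hc : 0 ≤ c)
    (h : ∀ ξ ∈ Metric.ball (0 : Space d) r, c ≤ ‖f ξ‖) :
    ENNReal.ofReal (c * √(lowMass d s r)) ≤ eLpNorm (weighted s f) 2 volume := by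
  refine (ENNReal.pow_le_pow_left_iff two_ne_zero).1 ?_
  calc ENNReal.ofReal (c * √(lowMass d s r)) ^ 2
      = ENNReal.ofReal (∫ ξ in Metric.ball (0 : Space d) r, c ^ 2 * weight s ξ ^ 2) := by
        rw [← ENNReal.ofReal_pow (by positivity), mul_pow, Real.sq_sqrt (lowMass_nonneg d s r),
          lowMass, integral_const_mul]
    _ = ∫⁻ ξ in Metric.ball (0 : Space d) r, ENNReal.ofReal (c ^ 2 * weight s ξ ^ 2) :=
        ofReal_integral_eq_lintegral_ofReal ((integrableOn_weight_sq s 0 r).const_mul _)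
          (Eventually.of_forall fun ξ ↦ by positivity)
    _ ≤ ∫⁻ ξ in Metric.ball (0 : Space d) r, ‖weighted s f ξ‖ₑ ^ 2 := by
        refine setLIntegral_mono' measurableSet_ball fun ξ hξ ↦ ?_
        rw [← ofReal_norm, ← ENNReal.ofReal_pow (norm_nonneg _), norm_weighted_apply, mul_comm,
          ← mul_pow]
        have := weight_pos s ξ
        gcongr
        exact h ξ hξ
    _ ≤ eLpNorm (weighted s f) 2 volume ^ 2 := by
        rw [eLpNorm_two_sq]
        exact setLIntegral_le_lintegral _ _

theorem ofReal_lt_eLpNorm_weighted {s : ℝ} (hs : s ≤ 0) {f g : FreqSpace d} {a c r : ℝ}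
    (ha : 0 ≤ a) (hc : 0 ≤ c) (h : ∀ ξ ∈ Metric.ball (0 : Space d) r, c ≤ ‖(f - g) ξ‖)
    (hlt : a + ‖g‖ < c * √(lowMass d s r)) :
    ENNReal.ofReal a < eLpNorm (weighted s f) 2 volume := by
  refine lt_of_add_lt_add_right (a := ENNReal.ofReal ‖g‖) ?_
  calc ENNReal.ofReal a + ENNReal.ofReal ‖g‖ = ENNReal.ofReal (a + ‖g‖) :=
        (ENNReal.ofReal_add ha (norm_nonneg g)).symm
    _ < ENNReal.ofReal (c * √(lowMass d s r)) :=
        (ENNReal.ofReal_lt_ofReal_iff_of_nonneg (by positivity)).2 hlt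
    _ ≤ eLpNorm (weighted s (f - g)) 2 volume := le_eLpNorm_weighted s hc h
    _ ≤ eLpNorm (weighted s f) 2 volume + eLpNorm (weighted s g) 2 volume := by
        rw [weighted_sub]
        exact eLpNorm_sub_le (aestronglyMeasurable_weighted s f)
          (aestronglyMeasurable_weighted s g) one_le_two
    _ ≤ eLpNorm (weighted s f) 2 volume + ENNReal.ofReal ‖g‖ := by
        gcongr; exact eLpNorm_weighted_le hs g

theorem norm_weighted_twoTents_le {s R A N : ℝ} (hs : s ≤ 0) (hR : 0 ≤ R) (hA : 0 < A)
    (hAN : 4 * A ≤ N) {η : Space d} (hη : ‖η‖ = N) (ξ : Space d) :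
    ‖weighted s (twoTents R A η) ξ‖ ≤ 2 * R * (N / 2) ^ s := by
  have hN : 0 < N / 2 := by linarith
  by_cases hξ : twoTents R A η ξ = 0
  · rw [weighted, hξ, mul_zero, norm_zero]
    positivity
  · rw [norm_weighted_apply, mul_comm]
    have := (weight_pos s ξ).le
    gcongr
    · exact (norm_apply_le _ ξ).trans (supNorm_twoTents_le hR hA η)
    · exact weight_le_rpow hs hN (norm_mem_Icc_of_twoTents_ne_zero hη hAN hξ).1

theorem eLpNorm_weighted_twoTents_le {s R A N : ℝ} (hs : s ≤ 0) (hR : 0 ≤ R) (hA : 0 < A)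
    (hAN : 4 * A ≤ N) {η : Space d} (hη : ‖η‖ = N) :
    eLpNorm (weighted s (twoTents R A η)) 2 volume ≤
      ENNReal.ofReal (2 * R * (N / 2) ^ s * √(2 * (A ^ d * ballVol d))) := by
  have hN : 0 < N / 2 := by linarith
  have hv := ballVol_pos (d := d)
  set S := Metric.ball η A ∪ Metric.ball ((2 : ℝ) • η) A
  have hsupp : Function.support (weighted s (twoTents R A η)) ⊆ S := fun ξ hξ ↦
    mem_ball_of_twoTents_ne_zero (right_ne_zero_of_mul hξ)
  have hvol : volume S ≤ ENNReal.ofReal (2 * (A ^ d * ballVol d)) := by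
    refine (measure_union_le _ _).trans_eq ?_
    rw [← ofReal_measureReal measure_ball_lt_top.ne, ← ofReal_measureReal measure_ball_lt_top.ne,
      volume_real_ball _ hA, volume_real_ball _ hA, ← ENNReal.ofReal_add (by positivity)
        (by positivity), two_mul]
  rw [← eLpNorm_restrict_eq_of_support_subset hsupp]
  refine (eLpNorm_le_of_ae_bound
    (Eventually.of_forall (norm_weighted_twoTents_le hs hR hA hAN hη))).trans ?_
  have hbound : 0 ≤ 2 * R * (N / 2) ^ s := by positivity
  have hV : 0 ≤ 2 * (A ^ d * ballVol d) := by positivity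
  rw [Measure.restrict_apply_univ, mul_comm, ENNReal.ofReal_mul hbound, Real.sqrt_eq_rpow,
    ← ENNReal.ofReal_rpow_of_nonneg hV (by norm_num), ENNReal.toReal_ofNat, ← one_div]
  gcongr

/-- The constraints on two tents under which they make the norm inflate: the Sobolev norm of the
tents is smaller than `ε`, while their effect at time `δ / N⁴ < ε` on low frequencies has Sobolev
norm larger than `ε⁻¹`. Here `δ` and `κ` are the constants of `exists_growth` and `P` is the norm
of the approximated datum. -/
structure IsInflationScale (d : ℕ) (s δ κ P ε N A R : ℝ) : Prop extends IsTentScale d N A R where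
  le_mass : P ≤ δ * (R * A ^ d)
  time_lt : δ / N ^ 4 < ε
  datum_lt : 2 * R * (N / 2) ^ s * √(2 * (A ^ d * ballVol d)) < ε
  lt_growth : ε⁻¹ < κ * (R * A ^ d / N) ^ 4 * R * √(lowMass d s (A / 2))

theorem normInflationAt_of_isInflationScale {s μ : ℝ} (hd : 0 < d) (hs : s ≤ 0) (hμ : μ ≠ 0)
    (hscale : ∀ δ κ P ε : ℝ, 0 < δ → 0 < κ → 0 < ε →
      ∃ N A R : ℝ, IsInflationScale d s δ κ P ε N A R)
    {u₀ : 𝓢'(Space d, ℂ)} (hu₀ : MemSobolev s 2 u₀) : NormInflationAt μ s u₀ := by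
  intro ε hε
  obtain ⟨δ, κ, hδ, hκ, hgrowth⟩ := exists_growth d hμ
  obtain ⟨ψ, hψ⟩ := exists_sobolevNorm_toPhys_sub_le hs hu₀ (half_pos hε)
  set ε' := (2 / ε + 2 * ‖ψ‖)⁻¹ with hε'_def
  have hε' : ε' ≤ ε / 2 := by
    rw [← inv_div 2 ε]
    exact inv_anti₀ (by positivity) (by linarith [norm_nonneg ψ])
  obtain ⟨N, A, R, h⟩ := hscale δ κ ‖ψ‖ ε' hδ hκ (by positivity)
  have hlarge := h.lt_growth
  rw [hε'_def, inv_inv] at hlarge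
  have hN := h.freq_pos
  have hR := h.height_pos
  have : Nonempty (Fin d) := ⟨⟨0, hd⟩⟩
  obtain ⟨η, hη⟩ := exists_norm_eq (Space d) hN.le
  obtain ⟨w, b, hw₀, hw, hb, hdiff⟩ := hgrowth h.toIsTentScale hη h.le_mass
  set T := δ / N ^ 4
  have hT : 0 < T := by positivity
  refine ⟨T, hT, solution w, isSolution_solution hs hw, ?_, T,
    ⟨hT, by linarith [h.time_lt]⟩, le_rfl, ?_⟩
  · rw [solution, evol_zero, hw₀]
    calc _ ≤ ENNReal.ofReal (ε / 2) + ENNReal.ofReal _ :=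
          (sobolevNorm_toPhys_add_sub_le hs ψ _ hu₀).trans (add_le_add hψ
            (eLpNorm_weighted_twoTents_le hs hR.le h.radius_pos h.four_mul_radius_le hη))
      _ < ENNReal.ofReal ε := by
          have := h.radius_pos
          have := ballVol_pos (d := d)
          rw [← ENNReal.ofReal_add (by positivity) (by positivity)]
          exact (ENNReal.ofReal_lt_ofReal_iff hε).2 (by linarith [h.datum_lt])
  · rw [sobolevNorm_solution hs]
    refine ofReal_lt_eLpNorm_weighted hs (by positivity) (by positivity) hdiff ?_
    have : 1 / ε < 2 / ε := by gcongr; exact one_lt_two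
    linarith

/-! ### The choice of the scales -/

theorem le_lowMass (d : ℕ) {s r : ℝ} (hs : s ≤ 0) (hr : 1 ≤ r) :
    2 ^ s * ballVol d * r ^ (2 * s + d) ≤ lowMass d s r := by
  have hr₀ : 0 < r := by linarith
  have hpow : r ^ (2 * s + d) = (r ^ 2) ^ s * r ^ d := by
    rw [Real.rpow_add hr₀, Real.rpow_natCast, Real.rpow_mul hr₀.le, Real.rpow_two]
  calc 2 ^ s * ballVol d * r ^ (2 * s + d)
      = ∫ _ in Metric.ball (0 : Space d) r, (2 * r ^ 2) ^ s := by
        rw [setIntegral_const, volume_real_ball _ hr₀, smul_eq_mul,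
          Real.mul_rpow zero_le_two (by positivity), hpow]
        ring
    _ ≤ lowMass d s r :=
        setIntegral_mono_on (integrableOn_const measure_ball_lt_top.ne)
          (integrableOn_weight_sq s 0 r) measurableSet_ball fun ξ hξ ↦
            le_weight_sq hs hr (mem_ball_zero_iff.1 hξ).le

section Subcritical

variable {n : ℕ} {s a : ℝ}

theorem exists_subcritical_exponent (hn : 0 < n) (hs : s < 0) (hs' : s < n / 2 - 1) :
    ∃ a : ℝ, 0 < a ∧ a < 1 ∧ 1 + s < a * (n / 2) ∧ a * (n / 2 - s) < 1 := by
  have : (1 : ℝ) ≤ n := by exact_mod_cast hn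
  have hq : 0 < (n : ℝ) / 2 - s := by linarith
  obtain ⟨a, hlow, hhigh⟩ : ∃ a : ℝ, max 0 ((1 + s) / (n / 2)) < a ∧ a < 1 / (n / 2 - s) := by
    refine exists_between (max_lt (by positivity) ?_)
    rw [div_lt_div_iff₀ (by positivity) hq]
    nlinarith
  have ha : 0 < a := (le_max_left _ _).trans_lt hlow
  have hsa : 1 + s < a * (n / 2) :=
    (div_lt_iff₀ (by positivity)).1 ((le_max_right _ _).trans_lt hlow)
  have hsa' : a * (n / 2 - s) < 1 := (lt_div_iff₀ hq).1 hhigh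
  exact ⟨a, ha, by nlinarith, hsa, hsa'⟩

theorem sqrt_rpow {N : ℝ} (hN : 0 ≤ N) (x : ℝ) : √(N ^ x) = N ^ (x / 2) := by
  rw [Real.sqrt_eq_rpow, ← Real.rpow_mul hN, mul_one_div]

theorem subcritical_mass {N : ℝ} (hN : 0 < N) (a : ℝ) (n : ℕ) :
    N ^ (1 - a * n) * (N ^ a) ^ n = N := by
  rw [← Real.rpow_mul_natCast hN.le, ← Real.rpow_add hN, sub_add_cancel, Real.rpow_one]

theorem subcritical_datum {N : ℝ} (hN : 0 < N) (a s : ℝ) (n : ℕ) :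
    2 * N ^ (1 - a * n) * (N / 2) ^ s * √(2 * ((N ^ a) ^ n * ballVol n)) =
      2 * (1 / 2) ^ s * √(2 * ballVol n) * N ^ (-(a * (n / 2) - (1 + s))) := by
  have hv := ballVol_pos (d := n)
  have hsqrt : √(2 * ((N ^ a) ^ n * ballVol n)) = √(2 * ballVol n) * N ^ (a * n / 2) := by
    rw [← sqrt_rpow hN.le, ← Real.sqrt_mul (by positivity), Real.rpow_mul_natCast hN.le]
    ring_nf
  have hexp : -(a * (n / 2) - (1 + s)) = (1 - a * n) + s + a * n / 2 := by ring
  rw [hsqrt, hexp, Real.rpow_add hN, Real.rpow_add hN, div_eq_mul_one_div,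
    Real.mul_rpow hN.le (by norm_num)]
  ring

theorem subcritical_growth (hs : s ≤ 0) {N : ℝ} (hN : 0 < N) (hA : 2 ≤ N ^ a) :
    √(2 ^ s * ballVol n * (1 / 2) ^ (2 * s + n)) * N ^ (1 - a * (n / 2 - s)) ≤
      N ^ (1 - a * n) * √(lowMass n s (N ^ a / 2)) := by
  have hv := ballVol_pos (d := n)
  have hc : 0 ≤ 2 ^ s * ballVol n * (1 / 2) ^ (2 * s + n) := by positivity
  have hexp : 1 - a * (n / 2 - s) = (1 - a * n) + a * (2 * s + n) / 2 := by ring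
  have hmass : 2 ^ s * ballVol n * (N ^ a / 2) ^ (2 * s + n) =
      2 ^ s * ballVol n * (1 / 2) ^ (2 * s + n) * N ^ (a * (2 * s + n)) := by
    rw [div_eq_mul_one_div, Real.mul_rpow (by positivity) (by norm_num), ← Real.rpow_mul hN.le]
    ring
  calc _ = N ^ (1 - a * n) * √(2 ^ s * ballVol n * (N ^ a / 2) ^ (2 * s + n)) := by
        rw [hmass, Real.sqrt_mul hc, sqrt_rpow hN.le, hexp, Real.rpow_add hN]
        ring
    _ ≤ _ := by gcongr; exact le_lowMass n hs (by linarith)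

theorem eventually_isInflationScale_subcritical (hs : s ≤ 0) (ha : 0 < a) (ha' : a < 1)
    (hdatum : 1 + s < a * (n / 2)) (hgrowth : a * (n / 2 - s) < 1) {δ κ P ε : ℝ} (hδ : 0 < δ)
    (hκ : 0 < κ) (hε : 0 < ε) :
    ∀ᶠ N in atTop, IsInflationScale n s δ κ P ε N (N ^ a) (N ^ (1 - a * n)) := by
  have hv := ballVol_pos (d := n)
  have hdatum_lim : Tendsto (fun N : ℝ ↦ 2 * (1 / 2) ^ s * √(2 * ballVol n) *
      N ^ (-(a * (n / 2) - (1 + s)))) atTop (𝓝 0) := by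
    simpa using (tendsto_rpow_neg_atTop (sub_pos.2 hdatum)).const_mul
      (2 * (1 / 2) ^ s * √(2 * ballVol n))
  have hgrowth_lim : Tendsto (fun N : ℝ ↦ κ * (√(2 ^ s * ballVol n * (1 / 2) ^ (2 * s + n)) *
      N ^ (1 - a * (n / 2 - s)))) atTop atTop :=
    ((tendsto_rpow_atTop (sub_pos.2 hgrowth)).const_mul_atTop (by positivity)).const_mul_atTop hκ
  have htime_lim : Tendsto (fun N : ℝ ↦ δ / N ^ 4) atTop (𝓝 0) :=
    tendsto_const_nhds.div_atTop (tendsto_pow_atTop four_ne_zero)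
  filter_upwards [eventually_gt_atTop 0, (tendsto_rpow_atTop ha).eventually_ge_atTop 2,
    (tendsto_rpow_atTop (sub_pos.2 ha')).eventually_ge_atTop 4,
    (tendsto_id.const_mul_atTop hδ).eventually_ge_atTop P, htime_lim.eventually_lt_const hε,
    hdatum_lim.eventually_lt_const hε, hgrowth_lim.eventually_gt_atTop ε⁻¹]
    with N hN hA hA' hP htime hsmall hlarge
  exact {
    one_le_radius := by linarith
    four_mul_radius_le := by
      calc 4 * N ^ a ≤ N ^ (1 - a) * N ^ a := by gcongr
        _ = N := by rw [← Real.rpow_add hN, sub_add_cancel, Real.rpow_one]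
    height_pos := by positivity
    mass_le := (subcritical_mass hN a n).le
    le_mass := by rwa [subcritical_mass hN]
    time_lt := htime
    datum_lt := by rwa [subcritical_datum hN]
    lt_growth := by
      rw [subcritical_mass hN, div_self hN.ne', one_pow, mul_one, mul_assoc]
      exact hlarge.trans_le (mul_le_mul_of_nonneg_left (subcritical_growth hs hN hA) hκ.le) }

end Subcritical

section Critical

theorem lowMass_mono (d : ℕ) (s : ℝ) : Monotone (lowMass d s) := fun _ r' h ↦
  setIntegral_mono_set (integrableOn_weight_sq s 0 r') (Eventually.of_forall fun _ ↦ sq_nonneg _)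
    (Metric.ball_subset_ball h).eventuallyLE

theorem lowMass_le {s r : ℝ} (hs : s ≤ 0) (hr : 0 < r) : lowMass d s r ≤ r ^ d * ballVol d := by
  have h : lowMass d s r ≤ ∫ _ in Metric.ball (0 : Space d) r, (1 : ℝ) :=
    setIntegral_mono_on (integrableOn_weight_sq s 0 r) (integrableOn_const measure_ball_lt_top.ne)
      measurableSet_ball fun ξ _ ↦ pow_le_one₀ (weight_pos s ξ).le (weight_le_one hs ξ)
  rwa [setIntegral_const, volume_real_ball _ hr, smul_eq_mul, mul_one] at h

theorem lowMass_add_le_lowMass_two_mul {r : ℝ} (hr : 1 ≤ r) :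
    lowMass 1 (-(1 / 2)) r + ballVol 1 / 4 ≤ lowMass 1 (-(1 / 2)) (2 * r) := by
  have hr₀ : 0 < r := by linarith
  have hsub : Metric.ball (0 : Space 1) r ⊆ Metric.ball 0 (2 * r) :=
    Metric.ball_subset_ball (by linarith)
  set S := Metric.ball (0 : Space 1) (2 * r) \ Metric.ball 0 r
  have hvol : volume.real S = r * ballVol 1 := by
    rw [measureReal_sdiff hsub measurableSet_ball, volume_real_ball _ hr₀,
      volume_real_ball _ (by positivity)]
    ring
  have hweight : ∀ ξ ∈ S, 1 / (4 * r) ≤ weight (-(1 / 2)) ξ ^ 2 := fun ξ hξ ↦ by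
    refine le_trans ?_ (le_weight_sq (by norm_num) (by linarith) (mem_ball_zero_iff.1 hξ.1).le)
    rw [Real.rpow_neg (by positivity), ← Real.sqrt_eq_rpow, ← one_div]
    refine one_div_le_one_div_of_le (by positivity) (Real.sqrt_le_iff.2 ⟨by positivity, ?_⟩)
    nlinarith [sq_nonneg r]
  have hannulus : ballVol 1 / 4 ≤ ∫ ξ in S, weight (-(1 / 2)) ξ ^ 2 := by
    calc ballVol 1 / 4 = ∫ _ in S, 1 / (4 * r) := by
          rw [setIntegral_const, hvol, smul_eq_mul]; field_simp
      _ ≤ _ := setIntegral_mono_on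
          (integrableOn_const ((measure_mono sdiff_subset).trans_lt measure_ball_lt_top).ne)
          ((integrableOn_weight_sq _ _ _).mono_set sdiff_subset)
          (measurableSet_ball.diff measurableSet_ball) hweight
  rw [setIntegral_sdiff measurableSet_ball (integrableOn_weight_sq _ _ _) hsub] at hannulus
  exact le_sub_iff_add_le'.1 hannulus

theorem tendsto_lowMass_atTop : Tendsto (lowMass 1 (-(1 / 2))) atTop atTop := by
  have hv := ballVol_pos (d := 1)
  have hdyadic : ∀ k : ℕ, k * (ballVol 1 / 4) ≤ lowMass 1 (-(1 / 2)) (2 ^ k) := fun k ↦ by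
    induction k with
    | zero => simpa using lowMass_nonneg 1 (-(1 / 2)) 1
    | succ k ih =>
      have := lowMass_add_le_lowMass_two_mul (r := 2 ^ k) (one_le_pow₀ one_le_two)
      rw [← pow_succ'] at this
      push_cast
      linarith
  refine tendsto_atTop_atTop_of_monotone (lowMass_mono _ _) fun c ↦ ?_
  obtain ⟨k, hk⟩ := exists_nat_ge (c / (ballVol 1 / 4))
  exact ⟨2 ^ k, ((div_le_iff₀ (by positivity)).1 hk).trans (hdyadic k)⟩

/-- The height of the tents of radius `A` in the critical case: a small negative power of the
logarithmically growing `lowMass`. -/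
noncomputable def criticalHeight (A : ℝ) : ℝ := lowMass 1 (-(1 / 2)) (A / 2) ^ (-(1 / 20) : ℝ)

theorem le_criticalHeight_mul {A : ℝ} (hA : 0 < A) (h : 1 ≤ lowMass 1 (-(1 / 2)) (A / 2)) :
    (√(ballVol 1 / 2))⁻¹ * √A ≤ criticalHeight A * A := by
  have hv := ballVol_pos (d := 1)
  have hmass : lowMass 1 (-(1 / 2)) (A / 2) ≤ ballVol 1 / 2 * A :=
    (lowMass_le (by norm_num) (by positivity)).trans_eq (by ring)
  calc (√(ballVol 1 / 2))⁻¹ * √A = (√(ballVol 1 / 2 * A))⁻¹ * A := by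
        rw [Real.sqrt_mul (by positivity), mul_inv, mul_assoc, inv_mul_eq_div (√A) A,
          Real.div_sqrt]
    _ ≤ (√(lowMass 1 (-(1 / 2)) (A / 2)))⁻¹ * A := by gcongr
    _ ≤ criticalHeight A * A := by
        gcongr
        rw [criticalHeight, Real.sqrt_eq_rpow, ← Real.rpow_neg (by linarith)]
        exact Real.rpow_le_rpow_of_exponent_le h (by norm_num)

theorem critical_datum (R : ℝ) {A : ℝ} (hA : 0 < A) :
    2 * R * (4 * A / 2) ^ (-(1 / 2) : ℝ) * √(2 * (A * ballVol 1)) = 2 * √(ballVol 1) * R := by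
  have hA' : 4 * A / 2 = 2 * A := by ring
  have hA₂ : 0 ≤ 2 * A := by positivity
  have hsqrt : √(2 * A) ≠ 0 := (Real.sqrt_pos.2 (by positivity)).ne'
  rw [hA', Real.rpow_neg hA₂, ← Real.sqrt_eq_rpow, ← mul_assoc 2 A, Real.sqrt_mul hA₂]
  field_simp

theorem critical_growth {A : ℝ} (hA : 0 < A) (h : 0 < lowMass 1 (-(1 / 2)) (A / 2)) :
    (criticalHeight A * A / (4 * A)) ^ 4 * criticalHeight A * √(lowMass 1 (-(1 / 2)) (A / 2)) =
      (1 / 4) ^ 4 * lowMass 1 (-(1 / 2)) (A / 2) ^ (1 / 4 : ℝ) := by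
  have hpow : criticalHeight A ^ 5 * √(lowMass 1 (-(1 / 2)) (A / 2)) =
      lowMass 1 (-(1 / 2)) (A / 2) ^ (1 / 4 : ℝ) := by
    rw [criticalHeight, ← Real.rpow_mul_natCast h.le, Real.sqrt_eq_rpow, ← Real.rpow_add h]
    norm_num
  rw [mul_div_mul_right _ _ hA.ne', ← hpow]
  ring

theorem eventually_isInflationScale_critical {δ κ P ε : ℝ} (hδ : 0 < δ) (hκ : 0 < κ)
    (hε : 0 < ε) :
    ∀ᶠ A in atTop, IsInflationScale 1 (-(1 / 2)) δ κ P ε (4 * A) A (criticalHeight A) := by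
  have hv := ballVol_pos (d := 1)
  have hlow : Tendsto (fun A : ℝ ↦ lowMass 1 (-(1 / 2)) (A / 2)) atTop atTop :=
    tendsto_lowMass_atTop.comp (tendsto_id.atTop_div_const two_pos)
  have hdatum_lim : Tendsto (fun A ↦ 2 * √(ballVol 1) * criticalHeight A) atTop (𝓝 0) := by
    have h := ((tendsto_rpow_neg_atTop (by norm_num : (0 : ℝ) < 1 / 20)).comp hlow).const_mul
      (2 * √(ballVol 1))
    rw [mul_zero] at h
    exact h
  have hgrowth_lim : Tendsto (fun A : ℝ ↦
      κ * ((1 / 4) ^ 4 * lowMass 1 (-(1 / 2)) (A / 2) ^ (1 / 4 : ℝ))) atTop atTop :=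
    (((tendsto_rpow_atTop (by norm_num)).comp hlow).const_mul_atTop
      (by positivity)).const_mul_atTop hκ
  have hmass_lim : Tendsto (fun A : ℝ ↦ δ * ((√(ballVol 1 / 2))⁻¹ * √A)) atTop atTop :=
    (Real.tendsto_sqrt_atTop.const_mul_atTop (by positivity)).const_mul_atTop hδ
  have htime_lim : Tendsto (fun A : ℝ ↦ δ / (4 * A) ^ 4) atTop (𝓝 0) :=
    tendsto_const_nhds.div_atTop
      ((tendsto_pow_atTop four_ne_zero).comp (tendsto_id.const_mul_atTop four_pos))
  filter_upwards [eventually_ge_atTop 1, hlow.eventually_ge_atTop 1,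
    hmass_lim.eventually_ge_atTop P, htime_lim.eventually_lt_const hε,
    hdatum_lim.eventually_lt_const hε, hgrowth_lim.eventually_gt_atTop ε⁻¹]
    with A hA hlow_ge hP htime hsmall hlarge
  have hA₀ : 0 < A := by linarith
  have hheight : criticalHeight A ≤ 1 :=
    Real.rpow_le_one_of_one_le_of_nonpos hlow_ge (by norm_num)
  exact {
    one_le_radius := hA
    four_mul_radius_le := le_rfl
    height_pos := Real.rpow_pos_of_pos (by linarith) _
    mass_le := by rw [pow_one]; nlinarith
    le_mass := by
      rw [pow_one]
      exact hP.trans (mul_le_mul_of_nonneg_left (le_criticalHeight_mul hA₀ hlow_ge) hδ.le)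
    time_lt := htime
    datum_lt := by rwa [pow_one, critical_datum _ hA₀]
    lt_growth := by
      rw [pow_one, mul_assoc, mul_assoc, ← mul_assoc (_ ^ 4), critical_growth hA₀ (by linarith)]
      exact hlarge }

end Critical

theorem exists_isInflationScale (hd : 0 < d) {s : ℝ} (hs₁ : d = 1 → s ≤ -(1 / 2)) (hs : s < 0)
    {δ κ : ℝ} (P : ℝ) {ε : ℝ} (hδ : 0 < δ) (hκ : 0 < κ) (hε : 0 < ε) :
    ∃ N A R : ℝ, IsInflationScale d s δ κ P ε N A R := by
  by_cases hcrit : d = 1 ∧ s = -(1 / 2)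
  · obtain ⟨rfl, rfl⟩ := hcrit
    obtain ⟨A, hA⟩ := (eventually_isInflationScale_critical hδ hκ hε).exists
    exact ⟨_, _, _, hA⟩
  · have hsub : s < d / 2 - 1 := by
      rcases Nat.succ_le_iff.2 hd |>.eq_or_lt with rfl | hd'
      · have := (hs₁ rfl).lt_of_ne fun h ↦ hcrit ⟨rfl, h⟩
        norm_num
        linarith
      · have : (2 : ℝ) ≤ d := by exact_mod_cast hd'
        linarith
    obtain ⟨a, ha, ha', hdatum, hgrowth⟩ := exists_subcritical_exponent hd hs hsub
    obtain ⟨N, hN⟩ := (eventually_isInflationScale_subcritical hs.le ha ha' hdatum hgrowth hδ hκ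
      hε).exists
    exact ⟨_, _, _, hN⟩

end FreqSpace

end QuinticFourthOrderNLS

open QuinticFourthOrderNLS in
theorem theorem1p1_general (d : ℕ) (hd : 1 ≤ d) (s : ℝ) (hs₁ : d = 1 → s ≤ -(1 / 2))
    (hs₂ : 2 ≤ d → s < 0) (μ : ℝ) (hμ : μ ≠ 0)
    (u₀ : 𝓢'(EuclideanSpace ℝ (Fin d), ℂ)) (hu₀ : MemSobolev s 2 u₀) :
    NormInflationAt μ s u₀ := by
  have hs : s < 0 := by
    rcases hd.eq_or_lt with rfl | hd'
    · linarith [hs₁ rfl]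
    · exact hs₂ hd'
  exact FreqSpace.normInflationAt_of_isInflationScale hd hs.le hμ
    (fun _ _ P _ ↦ FreqSpace.exists_isInflationScale hd hs₁ hs P) hu₀

theorem theorem1p1 (d : ℕ) (hd : 1 ≤ d) (s : ℝ) (hs₁ : d = 1 → s ≤ -(1 / 2))
    (hs₂ : 2 ≤ d → s < 0) (μ : ℝ) (hμ : μ = 1 ∨ μ = -1)
    (u₀ : 𝓢'(EuclideanSpace ℝ (Fin d), ℂ)) (hu₀ : MemSobolev s 2 u₀) :
    QuinticFourthOrderNLS.NormInflationAt μ s u₀ :=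
  theorem1p1_general d hd s hs₁ hs₂ μ (by rcases hμ with rfl | rfl <;> norm_num) u₀ hu₀
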